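/- \textbf{RCE noncoherent achievability bound.} Let $\ell,n_c\ge 1$ be integers, $\rho>0$, $\mu_H\in\mathbb C$ and $\sigma_H^2>0$. Consider the memoryless block-fading channel $Y_k=H_kx_k+W_k$, $k=1,\dots,\ell$, with $x_k,Y_k\in\mathbb C^{n_c}$, $H_k\sim\mathcal{CN}(\mu_H,\sigma_H^2)$ and $W_k\sim\mathcal{CN}(0,I_{n_c})$, all $H_k,W_k$ being independent (Rician fading with factor $\kappa\ge 0$ is the case $\mu_H=\sqrt{\kappa/(1+\kappa)}$, $\sigma_H^2=1/(1+\kappa)$). Let $P_{Y|X}$ be the conditional density of one output block given its input block. An $(\ell,n_c,M,\epsilon,\rho)$-code consists of codewords $c_m=[c_{m,1},\dots,c_{m,\ell}]$, $m=1,\dots,M$ ($M\ge1$), with $c_{m,k}\in\mathbb C^{n_c}$ and $\|c_{m,k}\|^2=n_c\rho$ for all $m,k$, and of a measurable decoder $g:(\mathbb C^{n_c})^\ell\to\{1,\dots,M\}$, whose average error probability $\frac1M\sum_{j=1}^M\Pr\{g(Y^\ell)\ne j\mid J=j\}$ is at most $\epsilon$. Let $R^*(\ell,n_c,\epsilon,\rho)\in[0,\infty]$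 be the supremum of $\frac{\log_2M}{\ell n_c}$ over all $M\ge1$ for which an $(\ell,n_c,M,\epsilon,\rho)$-code exists. For $\tau\in[0,1]$ put \[ c(\tau)=(1+\sigma_H^2\rho n_c)^\tau\,\Gamma(n_c)^\tau\, e^{-|\mu_H|^2/\sigma_H^2}\left[\frac{(1+\tau)^{n_c-2}}{\sigma_H^2}\right]^{1+\tau}, \] \[ J(r,\tau)=\int_0^\infty \frac{e^{-\frac{1}{1+\tau}(\sigma_H^{-2}+\rho n_c)z}}{(\sqrt{r\rho n_c z})^{n_c-1}}\, I_{n_c-1}\!\left(\frac{2\sqrt{r\rho n_c z}}{1+\tau}\right) I_0\!\left(\frac{2|\mu_H|\sqrt z}{\sigma_H^2(1+\tau)}\right)dz\qquad(r>0), \] \[ E_0(\tau)=-\log\left(c(\tau)\int_0^\infty r^{n_c-1}e^{-r}J(r,\tau)^{1+\tau}\,dr\right), \] where $I_\nu$ is the modified Bessel function of the first kind, and, for $R\in\mathbb R$ (in nats per channel use), \[ E(n_c,R,\rho)=\max_{0\le\tau\le1}\{E_0(\tau)-\tau n_cR\},\qquad \epsilon_{\mathrm{ub}}(\ell,n_c,M,\rho)=e^{-\ell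 E(n_c,R,\rho)}\ \text{ with } R=\frac{\log M}{n_c\ell}. \] Then the following hold. \begin{enumerate} \item For every $\tau\in[0,1]$ the integrals defining $J(r,\tau)$ ($r>0$) and $E_0(\tau)$ converge. \item Let $X$ be uniformly distributed on $\{x\in\mathbb C^{n_c}:\|x\|^2=n_c\rho\}$, let $Y$ be the corresponding output of one block, and for $s\ge0$ let $E_0(\tau,s)=-\log\mathbb E[e^{-\tau i_s(X,Y)}]\in[-\infty,\infty)$, where $i_s(x,y)=\log\frac{P_{Y|X}(y|x)^s}{\mathbb E[P_{Y|X}(y|X)^s]}$. For every $\tau\in[0,1]$, $E_0(\tau)=E_0(\tau,\tfrac1{1+\tau})$, and $s=\frac1{1+\tau}$ is the optimal choice: $E_0(\tau,s)\le E_0(\tau,\frac1{1+\tau})$ for all $s\ge0$. \item For every $R\in\mathbb R$ the maximum in the definition of $E(n_c,R,\rho)$ is attained. \item For every $M\ge1$ there is an $(\ell,n_c,M,\epsilon,\rho)$-code with $\epsilon=\epsilon_{\mathrm{ub}}(\ell,n_c,M,\rho)=e^{-\ell E(n_c,R,\rho)}$, $R=\frac{\log M}{n_c\ell}$, whose decoder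 is a maximum-likelihood decoder, that is, $g(y^\ell)$ maximizes $m\mapsto\prod_{k=1}^\ell P_{Y|X}(y_k|c_{m,k})$ for every $y^\ell$. \item For every $0<\epsilon<1$ the set of $M\ge1$ with $\epsilon_{\mathrm{ub}}(\ell,n_c,M,\rho)\le\epsilon$ is finite, and \[ R^*(\ell,n_c,\epsilon,\rho)\ \ge\ \max\left\{\frac{\log_2M}{n_c\ell}\,:\,M\ge1,\ \epsilon_{\mathrm{ub}}(\ell,n_c,M,\rho)\le\epsilon\right\} \] (the maximum over the empty set being $-\infty$). \end{enumerate} -/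

import Mathlib

open MeasureTheory Set

namespace BlockFading

noncomputable section

/-- Modified Bessel function of the first kind `I_ν`, of integer order `ν ≥ 0`. -/
def besselI (ν : ℕ) (x : ℝ) : ℝ :=
  ∑' k : ℕ, (x / 2) ^ (2 * k + ν) / ((k.factorial : ℝ) * ((k + ν).factorial : ℝ))

/-- The law `CN(m, v)` on `ℂ`: circularly symmetric complex Gaussian with mean `m` and
variance `v > 0`, given by its density with respect to Lebesgue measure. -/
def complexGaussian (m : ℂ) (v : ℝ) : Measure ℂ :=
  volume.withDensity fun z => ENNReal.ofReal ((Real.pi * v)⁻¹ * Real.exp (-(‖z - m‖ ^ 2) / v))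

/-- The vectors transmitted or received in one coherence block, with the `ℓ²` norm. -/
abbrev Block (n : ℕ) := EuclideanSpace ℂ (Fin n)

/-- The noise law `CN(0, I_n)`. -/
def noiseLaw (n : ℕ) : Measure (Block n) :=
  (Measure.pi fun _ : Fin n => complexGaussian 0 1).map (WithLp.toLp 2)

/-- The law of the output `Y = H x + W` of one coherence block with input `x`, where
`H ∼ CN(μ, v)` and `W ∼ CN(0, I_n)` are independent. -/
def blockLaw {n : ℕ} (μ : ℂ) (v : ℝ) (x : Block n) : Measure (Block n) :=
  ((complexGaussian μ v).prod (noiseLaw n)).map fun p => p.1 • x + p.2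

/-- The law of the output of `ℓ` blocks with inputs `x 1, …, x ℓ`; fading and noise are independent
over the blocks. -/
def channelLaw {ℓ n : ℕ} (μ : ℂ) (v : ℝ) (x : Fin ℓ → Block n) : Measure (Fin ℓ → Block n) :=
  Measure.pi fun k => blockLaw μ v (x k)

/-- The conditional density `P_{Y|X}(y|x) = E_H[π^{-n} exp(-‖y - H x‖²)]` of the output of one
block, with `H ∼ CN(μ, v)`. -/
def blockDensity {n : ℕ} (μ : ℂ) (v : ℝ) (x y : Block n) : ℝ :=
  ∫ h, (Real.pi ^ n)⁻¹ * Real.exp (-(‖y - h • x‖ ^ 2)) ∂(complexGaussian μ v)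

/-- The average error probability of the encoder `f` and the decoder `g` under uniformly
distributed messages. -/
def avgError {ℓ n M : ℕ} (μ : ℂ) (v : ℝ) (f : Fin M → Fin ℓ → Block n)
    (g : (Fin ℓ → Block n) → Fin M) : ℝ :=
  (1 / (M : ℝ)) * ∑ j, (channelLaw μ v (f j)).real {y | g y ≠ j}

/-- `(f, g)` is an `(ℓ, n, M, ε, ρ)`-code for the channel with fading law `CN(μ, v)`. -/
structure IsCode {ℓ n M : ℕ} (μ : ℂ) (v ε ρ : ℝ) (f : Fin M → Fin ℓ → Block n)
    (g : (Fin ℓ → Block n) → Fin M) : Prop where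
  power : ∀ m k, ‖f m k‖ ^ 2 = n * ρ
  measurable_decoder : Measurable g
  error_le : avgError μ v f g ≤ ε

/-- The decoder `g` maximizes the likelihood of the received signal. -/
def IsMaxLikelihood {ℓ n M : ℕ} (μ : ℂ) (v : ℝ) (f : Fin M → Fin ℓ → Block n)
    (g : (Fin ℓ → Block n) → Fin M) : Prop :=
  ∀ y m, ∏ k, blockDensity μ v (f m k) (y k) ≤ ∏ k, blockDensity μ v (f (g y) k) (y k)

/-- The maximum coding rate `R*(ℓ, n, ε, ρ)` in bits per channel use (a supremum in the extended
reals). -/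
def maxRate (ℓ n : ℕ) (μ : ℂ) (v ε ρ : ℝ) : EReal :=
  sSup {r : EReal | ∃ M : ℕ, 1 ≤ M ∧
    (∃ (f : Fin M → Fin ℓ → Block n) (g : (Fin ℓ → Block n) → Fin M), IsCode μ v ε ρ f g) ∧
    r = ((Real.logb 2 M / (ℓ * n) : ℝ) : EReal)}

/-- The shell distribution: the uniform distribution on `{x ∈ ℂⁿ : ‖x‖² = n ρ}`. -/
def shellLaw (n : ℕ) (ρ : ℝ) : Measure (Block n) :=
  Measure.map (fun u : Metric.sphere (0 : Block n) 1 => Real.sqrt (n * ρ) • (u : Block n))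
    (((volume : Measure (Block n)).toSphere univ)⁻¹ • (volume : Measure (Block n)).toSphere)

/-- The generalized information density
`i_s(x, y) = log (P_{Y|X}(y|x)^s / E[P_{Y|X}(y|X)^s])`, with `X` drawn from the shell. -/
def infoDensity {n : ℕ} (μ : ℂ) (v ρ s : ℝ) (x y : Block n) : ℝ :=
  Real.log (blockDensity μ v x y ^ s / ∫ x', blockDensity μ v x' y ^ s ∂(shellLaw n ρ))

/-- Gallager's function `E₀(τ, s) = -log E[exp(-τ i_s(X, Y))]`, with `X` drawn from the shell and
`Y` the corresponding output of one block (it is `-∞` if the expectation is infinite). -/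
def gallagerE0 (n : ℕ) (μ : ℂ) (v ρ τ s : ℝ) : EReal :=
  -ENNReal.log (∫⁻ x, ∫⁻ y, ENNReal.ofReal (Real.exp (-τ * infoDensity μ v ρ s x y))
    ∂(blockLaw μ v x) ∂(shellLaw n ρ))

/-- The constant `c(τ)`. -/
def cConst (n : ℕ) (μ : ℂ) (v ρ τ : ℝ) : ℝ :=
  (1 + v * ρ * n) ^ τ * Real.Gamma n ^ τ * Real.exp (-(‖μ‖ ^ 2) / v) *
    ((1 + τ) ^ ((n : ℝ) - 2) / v) ^ (1 + τ)

/-- The integrand of `J(r, τ)`. -/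
def jIntegrand (n : ℕ) (μ : ℂ) (v ρ r τ z : ℝ) : ℝ :=
  Real.exp (-(1 / (1 + τ)) * (v⁻¹ + ρ * n) * z) / Real.sqrt (r * ρ * n * z) ^ (n - 1) *
    besselI (n - 1) (2 * Real.sqrt (r * ρ * n * z) / (1 + τ)) *
    besselI 0 (2 * ‖μ‖ * Real.sqrt z / (v * (1 + τ)))

/-- `J(r, τ)`. -/
def jInt (n : ℕ) (μ : ℂ) (v ρ r τ : ℝ) : ℝ :=
  ∫ z in Ioi (0 : ℝ), jIntegrand n μ v ρ r τ z

/-- The integrand `r^{n-1} e^{-r} J(r, τ)^{1+τ}` of `E₀(τ)`. -/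
def e0Integrand (n : ℕ) (μ : ℂ) (v ρ τ r : ℝ) : ℝ :=
  r ^ (n - 1) * Real.exp (-r) * jInt n μ v ρ r τ ^ (1 + τ)

/-- The explicit function `E₀(τ)`. -/
def explicitE0 (n : ℕ) (μ : ℂ) (v ρ τ : ℝ) : ℝ :=
  -Real.log (cConst n μ v ρ τ * ∫ r in Ioi (0 : ℝ), e0Integrand n μ v ρ τ r)

/-- The random-coding error exponent `E(n, R, ρ) = max_{0 ≤ τ ≤ 1} {E₀(τ) - τ n R}`, with `R` in
nats per channel use (that the supremum is a maximum is part of the theorem). -/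
def rce (n : ℕ) (μ : ℂ) (v R ρ : ℝ) : ℝ :=
  sSup ((fun τ : ℝ => explicitE0 n μ v ρ τ - τ * n * R) '' Icc 0 1)

/-- The bound `ε_ub(ℓ, n, M, ρ) = exp(-ℓ E(n, R, ρ))` with `R = (log M) / (n ℓ)`. -/
def epsUB (ℓ n M : ℕ) (μ : ℂ) (v ρ : ℝ) : ℝ :=
  Real.exp (-(ℓ * rce n μ v (Real.log M / (n * ℓ)) ρ))

end

end BlockFading

open BlockFading

/-!
The explicit function is Gallager's function of the block channel, and the bound is Gallager's
random coding bound for codewords whose blocks are independent and uniform on the shell.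

*The explicit formula.* Up to a constant, the density `P(y|x)` is `∫ exp (-G(x, y, h)) dh` with
`G = ‖y - h x‖² + |h - μ|² / v`, and completing the square in `h` gives it in closed form. The same
computation with `s G` in place of `G` shows that `P(y|x) ^ s` is, up to a constant, the mixture
`∫ exp (-s G(x, y, h)) dh` (`ofReal_blockDensity_rpow`). In this mixture the mean over the shell and
the integral over the phase of `h` are both Laplace transforms of the surface measure of a sphere,
which are Bessel functions (`lintegral_sphere_exp_inner`); the latter is proved by comparing even
moments with those of a Gaussian. What remains is the integral over `z = |h|²`, which is `J(r, τ)`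
at `r = ‖y‖²` (`shellPower_eq_jInt`). Polar coordinates in the output space then give
`exp (-E₀(τ)) = ∫ E[P(y|X) ^ (1 / (1 + τ))] ^ (1 + τ) dy` (`gallagerIntegral_eq`). All of this is
Tonelli's theorem for nonnegative functions, and the convergence of the integrals follows from
`P ≤ 1` and from the bound `gallagerIntegral ≤ 1`, which is the monotonicity of power means.

*Optimality and the maximum.* Gallager's function at `s` is the negative logarithm of
`∫ E[P ^ s] ^ τ * E[P ^ (1 - s τ)] dy` (`gallagerE0_eq`), and Hölder's inequality bounds this
integrand from below by the one at `s = 1 / (1 + τ)`. Monotonicity of power means also supplies the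
integrable majorant `E[P(y|X)]` for dominated convergence, so that `E₀` is continuous in `τ` and
attains the maximum.

*Codes.* If maximum-likelihood decoding fails on the message `j`, another codeword is at least as
likely, so the likelihood of `y` is at most `W_j ^ s * (∑_{m ≠ j} W_m ^ s) ^ τ`
(`le_gallagerTerm`). Independence of the codewords and Jensen's inequality bound the mean of its
integral by `M ^ τ * exp (-ℓ E₀(τ))`, and some codebook is no worse than the mean
(`exists_codebook`). The bound exceeds a given `ε < 1` for all large `M` because `E₀` is continuous
with `E₀(0) = 0` (`finite_setOf_epsUB_le`), and for the other `M` the codes above witness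
the rate `log₂ M / (n ℓ)` (`sSup_le_maxRate`).
-/

namespace BlockFading

open scoped ENNReal

/-! ### Product measures, polar coordinates and Gaussian integrals -/

/-- Tonelli's theorem for a product of functions of the single coordinates. -/
theorem lintegral_fin_prod {n : ℕ} {α : Type*} [MeasurableSpace α]
    (μ : Fin n → Measure α) [∀ i, SigmaFinite (μ i)]
    (f : Fin n → α → ℝ≥0∞) (hf : ∀ i, Measurable (f i)) :
    ∫⁻ x, ∏ i, f i (x i) ∂(Measure.pi μ) = ∏ i, ∫⁻ a, f i a ∂(μ i) := by
  induction n with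
  | zero => simp
  | succ n ih =>
    have hmp := (measurePreserving_piFinSuccAbove μ 0).symm
    rw [← hmp.map_eq, lintegral_map_equiv, Fin.prod_univ_succ,
      ← ih (fun i => μ i.succ) (fun i => f i.succ) (fun i => hf _),
      ← lintegral_prod_mul (hf 0).aemeasurable
        (Finset.measurable_prod _ fun i _ => (hf i.succ).comp (measurable_pi_apply i)).aemeasurable]
    simp_rw [MeasurableEquiv.piFinSuccAbove_symm_apply, Fin.insertNthEquiv,
      Fin.prod_univ_succ, Fin.insertNth_zero, Equiv.coe_fn_mk, Fin.cons_succ,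
      Fin.zero_succAbove, cast_eq, Fin.cons_zero]

/-- A product of measures with densities has the product density. -/
theorem pi_withDensity {n : ℕ} {α : Type*} [MeasurableSpace α]
    (μ : Fin n → Measure α) [∀ i, SigmaFinite (μ i)]
    (f : Fin n → α → ℝ≥0∞) (hf : ∀ i, Measurable (f i))
    [∀ i, SigmaFinite ((μ i).withDensity (f i))] :
    Measure.pi (fun i => (μ i).withDensity (f i)) =
      (Measure.pi μ).withDensity fun x => ∏ i, f i (x i) := by
  refine Measure.pi_eq fun s hs => ?_
  rw [withDensity_apply _ (MeasurableSet.univ_pi hs),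
    ← lintegral_indicator (MeasurableSet.univ_pi hs)]
  calc _ = ∫⁻ x, ∏ i, (s i).indicator (f i) (x i) ∂(Measure.pi μ) := by
        refine lintegral_congr fun x => ?_
        by_cases hx : x ∈ univ.pi s
        · rw [indicator_of_mem hx]
          exact Finset.prod_congr rfl fun i _ => (indicator_of_mem (hx i (mem_univ i)) _).symm
        · rw [indicator_of_notMem hx]
          simp only [mem_univ_pi, not_forall] at hx
          obtain ⟨i, hi⟩ := hx
          exact (Finset.prod_eq_zero (Finset.mem_univ i) (indicator_of_notMem hi _)).symm
    _ = ∏ i, ∫⁻ a, (s i).indicator (f i) a ∂(μ i) :=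
        lintegral_fin_prod μ _ fun i => (hf i).indicator (hs i)
    _ = _ := by
        refine Finset.prod_congr rfl fun i _ => ?_
        rw [lintegral_indicator (hs i), withDensity_apply _ (hs i)]

/-- Jensen's inequality for the concave function `t ↦ t ^ τ`, `0 ≤ τ ≤ 1`. -/
theorem lintegral_rpow_le {α : Type*} [MeasurableSpace α] {P : Measure α} [IsProbabilityMeasure P]
    {f : α → ℝ≥0∞} (hf : Measurable f) {τ : ℝ} (h0 : 0 ≤ τ) (h1 : τ ≤ 1) :
    ∫⁻ a, f a ^ τ ∂P ≤ (∫⁻ a, f a ∂P) ^ τ := by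
  simpa using ENNReal.lintegral_mul_norm_pow_le (μ := P) hf.aemeasurable
    (aemeasurable_const (b := (1 : ℝ≥0∞))) h0 (sub_nonneg.2 h1) (add_sub_cancel τ 1)

/-- Integration in polar coordinates in even real dimension `2 n`, with the squared radius as
radial variable. -/
theorem lintegral_polar {E : Type*} [NormedAddCommGroup E] [NormedSpace ℝ E] [MeasurableSpace E]
    [BorelSpace E] [FiniteDimensional ℝ E] [Nontrivial E] (κ : Measure E) [κ.IsAddHaarMeasure]
    {n : ℕ} (hn : 1 ≤ n) (hdim : Module.finrank ℝ E = 2 * n) {f : E → ℝ≥0∞} (hf : Measurable f) :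
    ∫⁻ x, f x ∂κ = ∫⁻ z in Ioi (0 : ℝ), ENNReal.ofReal (z ^ (n - 1) / 2) *
      ∫⁻ u, f (Real.sqrt z • (u : E)) ∂κ.toSphere := by
  have hmeas : Measurable fun r : ℝ => ∫⁻ u, f (r • (u : E)) ∂κ.toSphere := by
    apply Measurable.lintegral_prod_right'
      (f := fun p : ℝ × Metric.sphere (0 : E) 1 => f (p.1 • (p.2 : E)))
    fun_prop
  calc
    ∫⁻ x, f x ∂κ = ∫⁻ x : ({(0)}ᶜ : Set E), f x.1 ∂(κ.comap (↑)) := by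
      rw [lintegral_subtype_comap (measurableSet_singleton _).compl f,
        restrict_compl_singleton]
    _ = ∫⁻ p, f (p.2.1 • (p.1 : E)) ∂κ.toSphere.prod (.volumeIoiPow (Module.finrank ℝ E - 1)) := by
      rw [← κ.measurePreserving_homeomorphUnitSphereProd.lintegral_comp_emb
        (Homeomorph.measurableEmbedding _)]
      refine lintegral_congr fun x => ?_
      have hx : ‖(x : E)‖ ≠ 0 := norm_ne_zero_iff.2 x.2
      simp [smul_smul, hx]
    _ = ∫⁻ r : Ioi (0 : ℝ), ∫⁻ u, f (r.1 • (u : E)) ∂κ.toSphere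
          ∂(Measure.volumeIoiPow (Module.finrank ℝ E - 1)) := by
      rw [lintegral_prod_symm]
      exact Measurable.aemeasurable (by fun_prop)
    _ = ∫⁻ r in Ioi (0 : ℝ), ENNReal.ofReal (r ^ (2 * n - 1)) *
          ∫⁻ u, f (r • (u : E)) ∂κ.toSphere := by
      have h := lintegral_withDensity_eq_lintegral_mul
        ((volume : Measure ℝ).comap (Subtype.val : Ioi (0 : ℝ) → ℝ))
        (f := fun r => ENNReal.ofReal (r.1 ^ (2 * n - 1))) (by fun_prop)
        (hmeas.comp measurable_subtype_coe)
      rw [Measure.volumeIoiPow, hdim]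
      refine h.trans ?_
      exact lintegral_subtype_comap measurableSet_Ioi fun r => ENNReal.ofReal (r ^ (2 * n - 1)) *
          ∫⁻ u, f (r • (u : E)) ∂κ.toSphere
    _ = _ := by
      -- The substitution `z = r ^ 2` halves the exponent of the radial variable.
      have himg : (fun r : ℝ => r ^ 2) '' Ioi 0 = Ioi 0 := by
        ext z
        constructor
        · rintro ⟨r, hr, rfl⟩
          exact pow_pos (mem_Ioi.1 hr) 2
        · intro hz
          exact ⟨Real.sqrt z, Real.sqrt_pos.2 hz, Real.sq_sqrt (le_of_lt hz)⟩
      conv_rhs => rw [← himg]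
      rw [lintegral_image_eq_lintegral_abs_deriv_mul (f' := fun r => 2 * r) measurableSet_Ioi
        (fun r _ => by simpa using (hasDerivAt_pow 2 r).hasDerivWithinAt)
        (fun a ha b hb h => by
          simpa [abs_of_pos (mem_Ioi.1 ha), abs_of_pos (mem_Ioi.1 hb)] using
            (sq_eq_sq_iff_abs_eq_abs a b).1 h)]
      refine setLIntegral_congr_fun measurableSet_Ioi fun r hr => ?_
      have hr : 0 < r := hr
      simp only [Real.sqrt_sq hr.le]
      rw [← mul_assoc, ← ENNReal.ofReal_mul (abs_nonneg _), abs_of_pos (by positivity)]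
      congr 2
      obtain ⟨k, rfl⟩ := Nat.exists_eq_add_of_le' hn
      have : 2 * (k + 1) - 1 = 2 * k + 1 := by omega
      rw [this, Nat.add_sub_cancel]
      ring

/-- The Gaussian integral with a linear term. -/
theorem integral_exp_neg_mul_sq_add_inner {E : Type*} [NormedAddCommGroup E]
    [InnerProductSpace ℝ E] [FiniteDimensional ℝ E] [MeasurableSpace E] [BorelSpace E]
    {b : ℝ} (hb : 0 < b) (w : E) :
    ∫ h, Real.exp (-b * ‖h‖ ^ 2 + inner ℝ w h) =
      (Real.pi / b) ^ (Module.finrank ℝ E / 2 : ℝ) * Real.exp (‖w‖ ^ 2 / (4 * b)) := by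
  have h := GaussianFourier.integral_cexp_neg_mul_sq_norm_add (b := (b : ℂ)) (V := E)
    (by simpa using hb) 1 w
  have h2 : (((∫ h, Real.exp (-b * ‖h‖ ^ 2 + inner ℝ w h) : ℝ)) : ℂ) =
      ((Real.pi / b) ^ (Module.finrank ℝ E / 2 : ℝ) * Real.exp (‖w‖ ^ 2 / (4 * b)) : ℝ) := by
    rw [← integral_complex_ofReal]
    push_cast
    rw [Complex.ofReal_cpow (by positivity)]
    push_cast
    simpa using h
  exact_mod_cast h2

theorem lintegral_exp_neg_mul_sq_add_inner {E : Type*} [NormedAddCommGroup E]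
    [InnerProductSpace ℝ E] [FiniteDimensional ℝ E] [MeasurableSpace E] [BorelSpace E]
    {b : ℝ} (hb : 0 < b) (w : E) :
    ∫⁻ h, ENNReal.ofReal (Real.exp (-b * ‖h‖ ^ 2 + inner ℝ w h)) =
      ENNReal.ofReal ((Real.pi / b) ^ (Module.finrank ℝ E / 2 : ℝ) *
        Real.exp (‖w‖ ^ 2 / (4 * b))) := by
  rw [← integral_exp_neg_mul_sq_add_inner hb w, ofReal_integral_eq_lintegral_ofReal]
  · by_contra hi
    have := integral_exp_neg_mul_sq_add_inner hb w
    rw [integral_undef hi] at this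
    have : 0 < (Real.pi / b) ^ (Module.finrank ℝ E / 2 : ℝ) * Real.exp (‖w‖ ^ 2 / (4 * b)) := by
      positivity
    linarith
  · exact Filter.Eventually.of_forall fun h => (Real.exp_pos _).le

theorem finrank_block (n : ℕ) : Module.finrank ℝ (Block n) = 2 * n := by
  rw [← Module.finrank_mul_finrank ℝ ℂ (Block n)]
  simp

theorem lintegral_exp_neg_sq_block (n : ℕ) :
    ∫⁻ y : Block n, ENNReal.ofReal (Real.exp (-‖y‖ ^ 2)) = ENNReal.ofReal (Real.pi ^ n) := by
  have := lintegral_exp_neg_mul_sq_add_inner (E := Block n) one_pos 0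
  simpa [finrank_block] using this

theorem lintegral_exp_neg_sq_complex :
    ∫⁻ y : ℂ, ENNReal.ofReal (Real.exp (-‖y‖ ^ 2)) = ENNReal.ofReal Real.pi := by
  have := lintegral_exp_neg_mul_sq_add_inner (E := ℂ) one_pos 0
  simpa using this

/-- The volume on the inner product space `ℂⁿ` is the product of the volumes on `ℂ`: the two
Haar measures give the same value to the integral of a Gaussian function. -/
theorem map_toLp_pi_volume (n : ℕ) :
    (Measure.pi fun _ : Fin n => (volume : Measure ℂ)).map (WithLp.toLp 2) =
      (volume : Measure (Block n)) := by
  have hm : Measurable (WithLp.toLp 2 : (Fin n → ℂ) → Block n) :=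
    (PiLp.continuous_toLp 2 _).measurable
  have : ((Measure.pi fun _ : Fin n => (volume : Measure ℂ)).map
      (WithLp.toLp 2 : (Fin n → ℂ) → Block n)).IsAddHaarMeasure :=
    (PiLp.continuousLinearEquiv 2 ℝ (fun _ : Fin n => ℂ)).symm.isAddHaarMeasure_map
      (Measure.pi fun _ : Fin n => (volume : Measure ℂ))
  -- Two Haar measures are proportional; the Gaussian integral shows that the factor is one.
  have key := Measure.isAddLeftInvariant_eq_smul
    ((Measure.pi fun _ : Fin n => (volume : Measure ℂ)).map
      (WithLp.toLp 2 : (Fin n → ℂ) → Block n)) (volume : Measure (Block n))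
  set c := Measure.addHaarScalarFactor ((Measure.pi fun _ : Fin n => (volume : Measure ℂ)).map
      (WithLp.toLp 2 : (Fin n → ℂ) → Block n)) (volume : Measure (Block n)) with hc
  have h1 : ∫⁻ y : Block n, ENNReal.ofReal (Real.exp (-‖y‖ ^ 2))
      ∂((Measure.pi fun _ : Fin n => (volume : Measure ℂ)).map (WithLp.toLp 2)) =
      ENNReal.ofReal (Real.pi ^ n) := by
    rw [lintegral_map (by fun_prop) hm]
    have : ∀ x : Fin n → ℂ, ENNReal.ofReal (Real.exp (-‖(WithLp.toLp 2 x : Block n)‖ ^ 2)) =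
        ∏ i, ENNReal.ofReal (Real.exp (-‖x i‖ ^ 2)) := by
      intro x
      rw [← ENNReal.ofReal_prod_of_nonneg fun i _ => (Real.exp_pos _).le, ← Real.exp_sum,
        EuclideanSpace.norm_sq_eq, Finset.sum_neg_distrib]
    simp_rw [this]
    rw [lintegral_fin_prod _ (fun _ z => ENNReal.ofReal (Real.exp (-‖z‖ ^ 2)))
      (fun i => by fun_prop)]
    simp [lintegral_exp_neg_sq_complex, ENNReal.ofReal_pow Real.pi_pos.le]
  rw [key, lintegral_smul_measure, lintegral_exp_neg_sq_block] at h1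
  have hpi : ENNReal.ofReal (Real.pi ^ n) ≠ 0 := by
    simp [pow_pos Real.pi_pos n]
  have hc1 : (c : ℝ≥0∞) = 1 := by
    have h2 : (c : ℝ≥0∞) * ENNReal.ofReal (Real.pi ^ n) = 1 * ENNReal.ofReal (Real.pi ^ n) := by
      rw [one_mul]; exact h1
    exact (ENNReal.mul_left_inj hpi ENNReal.ofReal_ne_top).1 h2
  rw [key]
  have : c = 1 := by exact_mod_cast hc1
  rw [this, one_smul]

/-! ### Bessel functions as Laplace transforms of the sphere -/

/-- The entire series `∑ q ^ k / (k! (k + p)!)`, in terms of which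
`I_p (2 t) = t ^ p * besselSeries p (t ^ 2)`. -/
noncomputable def besselSeries (p : ℕ) (q : ℝ) : ℝ :=
  ∑' k : ℕ, q ^ k / ((k.factorial : ℝ) * ((k + p).factorial : ℝ))

theorem summable_besselSeries (p : ℕ) (q : ℝ) :
    Summable fun k : ℕ => q ^ k / ((k.factorial : ℝ) * ((k + p).factorial : ℝ)) := by
  refine (Real.summable_pow_div_factorial |q|).of_norm_bounded fun k => ?_
  have h1 : (0 : ℝ) < k.factorial := by positivity
  have h2 : (1 : ℝ) ≤ (k + p).factorial := by exact_mod_cast Nat.factorial_pos (k + p)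
  rw [norm_div, norm_pow, Real.norm_eq_abs, Real.norm_of_nonneg (by positivity)]
  gcongr
  nlinarith

theorem besselSeries_nonneg (p : ℕ) {q : ℝ} (hq : 0 ≤ q) : 0 ≤ besselSeries p q :=
  tsum_nonneg fun _ => by positivity

theorem measurable_besselSeries (p : ℕ) : Measurable (besselSeries p) := by
  refine measurable_of_tendsto_metrizable (f := fun (N : ℕ) (q : ℝ) => ∑ k ∈ Finset.range N,
    q ^ k / ((k.factorial : ℝ) * ((k + p).factorial : ℝ))) (fun N => by fun_prop) ?_
  rw [tendsto_pi_nhds]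
  exact fun q => (summable_besselSeries p q).hasSum.tendsto_sum_nat

theorem besselI_two_mul (p : ℕ) (t : ℝ) : besselI p (2 * t) = t ^ p * besselSeries p (t ^ 2) := by
  rw [besselI, besselSeries, ← tsum_mul_left]
  refine tsum_congr fun k => ?_
  rw [mul_div_cancel_left₀ _ two_ne_zero, pow_add, pow_mul]
  ring

theorem lintegral_pow_mul_exp_neg (m : ℕ) :
    ∫⁻ z in Ioi (0 : ℝ), ENNReal.ofReal (z ^ m * Real.exp (-z)) =
      ENNReal.ofReal (m.factorial : ℝ) := by
  have hm : (0 : ℝ) < (m : ℝ) + 1 := by positivity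
  have hi := Real.GammaIntegral_convergent hm
  rw [← Real.Gamma_nat_eq_factorial, Real.Gamma_eq_integral hm,
    ofReal_integral_eq_lintegral_ofReal hi]
  · refine setLIntegral_congr_fun measurableSet_Ioi fun z _ => ?_
    simp only [add_sub_cancel_right, Real.rpow_natCast, mul_comm]
  · refine (ae_restrict_iff' measurableSet_Ioi).2 (Filter.Eventually.of_forall fun z hz => ?_)
    have : (0 : ℝ) < z := hz
    exact mul_nonneg (Real.exp_pos _).le (Real.rpow_nonneg this.le _)

/-- Even moments of the Gaussian function on the line. -/
theorem lintegral_pow_mul_exp_neg_sq (k : ℕ) :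
    ∫⁻ x : ℝ, ENNReal.ofReal (x ^ (2 * k) * Real.exp (-x ^ 2)) =
      ENNReal.ofReal (Real.sqrt Real.pi * ((2 * k).factorial / (k.factorial * 4 ^ k))) := by
  have h2 := integral_rpow_mul_exp_neg_rpow (p := 2) (q := 2 * k) two_pos
    (by have : (0 : ℝ) ≤ k := by positivity
        linarith)
  have hI : ∫ x in Ioi (0 : ℝ), x ^ (2 * k) * Real.exp (-x ^ 2) =
      1 / 2 * Real.Gamma ((2 * k + 1) / 2) := by
    rw [← h2]
    refine setIntegral_congr_fun measurableSet_Ioi fun x _ => ?_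
    rw [← Real.rpow_natCast x (2 * k), ← Real.rpow_natCast x 2]
    push_cast
    rfl
  have hG : Real.Gamma ((2 * k + 1) / 2) =
      Real.sqrt Real.pi * ((2 * k).factorial / (k.factorial * 4 ^ k)) := by
    rw [show ((2 * k + 1) / 2 : ℝ) = k + 1 / 2 by ring, Real.Gamma_nat_add_half]
    have hd : ((2 * k).factorial : ℝ) =
        2 ^ k * k.factorial * ((2 * k - 1).doubleFactorial : ℕ) := by
      rcases k with _ | k
      · simp
      · have := Nat.factorial_eq_mul_doubleFactorial (2 * k + 1)
        rw [show 2 * k + 1 + 1 = 2 * (k + 1) by ring, Nat.doubleFactorial_two_mul] at this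
        rw [show 2 * (k + 1) - 1 = 2 * k + 1 by omega]
        exact_mod_cast this
    rw [hd, show (4 : ℝ) = 2 * 2 by norm_num, mul_pow]
    have : (k.factorial : ℝ) ≠ 0 := by positivity
    field_simp
  have hint : Integrable fun x : ℝ => x ^ (2 * k) * Real.exp (-x ^ 2) := by
    have := integrable_rpow_mul_exp_neg_mul_sq (b := 1) one_pos (s := 2 * k)
      (by have : (0 : ℝ) ≤ k := by positivity
          linarith)
    refine this.congr (Filter.Eventually.of_forall fun x => ?_)
    simp only [neg_mul, one_mul]
    rw [← Real.rpow_natCast x (2 * k)]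
    push_cast
    rfl
  rw [← ofReal_integral_eq_lintegral_ofReal hint]
  · have := integral_comp_abs (f := fun x : ℝ => x ^ (2 * k) * Real.exp (-x ^ 2))
    simp only [pow_mul, sq_abs] at this hI ⊢
    rw [this, hI, hG]
    congr 1
    ring
  · refine Filter.Eventually.of_forall fun x => ?_
    exact mul_nonneg ((even_two_mul k).pow_nonneg x) (Real.exp_pos _).le

section Sphere

variable {E : Type*} [NormedAddCommGroup E] [InnerProductSpace ℝ E] [MeasurableSpace E]
    [BorelSpace E] [FiniteDimensional ℝ E]

/-- Even moments of a linear functional under the Gaussian function: only the coordinate in the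
direction of the functional matters. -/
theorem lintegral_inner_pow_mul_exp_neg_sq {n : ℕ} (hdim : Module.finrank ℝ E = n + 1)
    (w : E) (k : ℕ) :
    ∫⁻ y : E, ENNReal.ofReal (inner ℝ w y ^ (2 * k) * Real.exp (-‖y‖ ^ 2)) =
      ENNReal.ofReal (Real.sqrt Real.pi ^ (n + 1) *
        (‖w‖ ^ (2 * k) * ((2 * k).factorial / (k.factorial * 4 ^ k)))) := by
  obtain ⟨e, he, hw⟩ : ∃ e : E, ‖e‖ = 1 ∧ w = ‖w‖ • e := by
    by_cases h : w = 0
    · have : Nontrivial E := Module.nontrivial_of_finrank_pos (R := ℝ) (by omega)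
      obtain ⟨e, he⟩ := exists_norm_eq E zero_le_one
      exact ⟨e, he, by simp [h]⟩
    · refine ⟨‖w‖⁻¹ • w, ?_, ?_⟩
      · simp [norm_smul, h]
      · rw [smul_smul, mul_inv_cancel₀ (norm_ne_zero_iff.2 h), one_smul]
  -- In an orthonormal basis that starts with the direction `e` of `w` the integrand is a product.
  obtain ⟨b, hb⟩ := Orthonormal.exists_orthonormalBasis_extension_of_card_eq
    (𝕜 := ℝ) (ι := Fin (n + 1)) (by simpa using hdim) (v := fun _ => e) (s := {0})
    ⟨fun _ => he, fun i j hij => (hij (Subsingleton.elim i j)).elim⟩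
  have hb0 : b 0 = e := hb 0 rfl
  have hcoord : ∀ x : EuclideanSpace ℝ (Fin (n + 1)), inner ℝ w (b.repr.symm x) = ‖w‖ * x 0 := by
    intro x
    rw [hw, inner_smul_left, ← hb0, ← b.repr_apply_apply]
    simp [norm_smul, hb0, he]
  rw [← b.measurePreserving_repr_symm.lintegral_comp_emb
      b.repr.symm.toHomeomorph.measurableEmbedding,
    ← (PiLp.volume_preserving_toLp (Fin (n + 1))).lintegral_comp_emb
      (MeasurableEquiv.toLp 2 (Fin (n + 1) → ℝ)).measurableEmbedding]
  have hprod : ∀ x : Fin (n + 1) → ℝ,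
      ENNReal.ofReal (inner ℝ w (b.repr.symm (WithLp.toLp 2 x)) ^ (2 * k) *
        Real.exp (-‖b.repr.symm (WithLp.toLp 2 x)‖ ^ 2)) =
      ENNReal.ofReal (‖w‖ ^ (2 * k)) * ∏ i, (fun (i : Fin (n + 1)) (a : ℝ) => ENNReal.ofReal
        (a ^ (2 * (if i = 0 then k else 0)) * Real.exp (-a ^ 2))) i (x i) := by
    intro x
    rw [hcoord, LinearIsometryEquiv.norm_map, EuclideanSpace.norm_sq_eq, Finset.prod_congr rfl
      (fun i _ => rfl), ← ENNReal.ofReal_prod_of_nonneg, ← ENNReal.ofReal_mul (by positivity)]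
    · rw [Finset.prod_mul_distrib, ← Real.exp_sum, Finset.sum_neg_distrib,
        Fin.prod_univ_succ (fun i => x i ^ (2 * (if i = 0 then k else 0)))]
      simp [Fin.succ_ne_zero, mul_pow, mul_assoc]
    · intro i _
      exact mul_nonneg ((even_two_mul _).pow_nonneg _) (Real.exp_pos _).le
  simp_rw [hprod]
  rw [lintegral_const_mul _ (Finset.measurable_prod _ fun i _ => by fun_prop), volume_pi,
    lintegral_fin_prod _ (fun (i : Fin (n + 1)) (a : ℝ) => ENNReal.ofReal
        (a ^ (2 * (if i = 0 then k else 0)) * Real.exp (-a ^ 2))) (fun i => by fun_prop)]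
  simp_rw [lintegral_pow_mul_exp_neg_sq]
  rw [← ENNReal.ofReal_prod_of_nonneg fun i _ => by positivity,
    ← ENNReal.ofReal_mul (by positivity), Fin.prod_univ_succ]
  congr 1
  simp only [Fin.succ_ne_zero, if_true, if_false, mul_zero, Nat.factorial_zero, Nat.cast_one,
    pow_zero, mul_one, div_one, Finset.prod_const, Finset.card_univ, Fintype.card_fin]
  ring

variable [Nontrivial E]

/-- The Gaussian integral of a homogeneous function is a multiple of its integral over the
sphere. -/
theorem lintegral_homogeneous {p : ℕ} (hdim : Module.finrank ℝ E = 2 * (p + 1))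
    {g : E → ℝ≥0∞} (hg : Measurable g) (k : ℕ)
    (hhom : ∀ r : ℝ, 0 < r → ∀ x, g (r • x) = ENNReal.ofReal (r ^ (2 * k)) * g x) :
    ∫⁻ y, g y * ENNReal.ofReal (Real.exp (-‖y‖ ^ 2)) =
      ENNReal.ofReal ((p + k).factorial / 2) * ∫⁻ u, g (u : E) ∂(volume : Measure E).toSphere := by
  rw [lintegral_polar volume (by omega) hdim (by fun_prop)]
  have h1 : ∀ z ∈ Ioi (0 : ℝ), ENNReal.ofReal (z ^ (p + 1 - 1) / 2) *
      ∫⁻ u, g (Real.sqrt z • (u : E)) * ENNReal.ofReal (Real.exp (-‖Real.sqrt z • (u : E)‖ ^ 2))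
        ∂(volume : Measure E).toSphere =
      ENNReal.ofReal (z ^ (p + k) * Real.exp (-z)) *
        (ENNReal.ofReal (1 / 2) * ∫⁻ u, g (u : E) ∂(volume : Measure E).toSphere) := by
    intro z hz
    have hz : 0 < z := hz
    have h2 : ∀ u : Metric.sphere (0 : E) 1,
        g (Real.sqrt z • (u : E)) * ENNReal.ofReal (Real.exp (-‖Real.sqrt z • (u : E)‖ ^ 2)) =
        ENNReal.ofReal (z ^ k * Real.exp (-z)) * g u := by
      intro u
      rw [hhom _ (Real.sqrt_pos.2 hz), pow_mul, Real.sq_sqrt hz.le, norm_smul,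
        Real.norm_of_nonneg (Real.sqrt_nonneg z), norm_eq_of_mem_sphere u, mul_one,
        Real.sq_sqrt hz.le, ENNReal.ofReal_mul (by positivity)]
      ring
    simp_rw [h2]
    rw [lintegral_const_mul' _ _ ENNReal.ofReal_ne_top, ← mul_assoc, ← mul_assoc,
      ← ENNReal.ofReal_mul (by positivity), ← ENNReal.ofReal_mul (by positivity)]
    congr 2
    rw [Nat.add_sub_cancel]
    ring
  rw [setLIntegral_congr_fun measurableSet_Ioi h1, lintegral_mul_const _ (by fun_prop),
    lintegral_pow_mul_exp_neg, ← mul_assoc, ← ENNReal.ofReal_mul (by positivity)]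
  congr 2
  ring

/-- The surface measure of the unit sphere in real dimension `2 (p + 1)`. -/
theorem toSphere_univ_eq {p : ℕ} (hdim : Module.finrank ℝ E = 2 * (p + 1)) :
    (volume : Measure E).toSphere univ = ENNReal.ofReal (2 * Real.pi ^ (p + 1) / p.factorial) := by
  have h1 := lintegral_homogeneous (E := E) hdim (g := fun _ => 1) measurable_const 0
    (fun r _ x => by simp)
  have h2 := lintegral_exp_neg_mul_sq_add_inner (E := E) one_pos 0
  simp only [inner_zero_left, add_zero, neg_mul, one_mul, div_one, norm_zero] at h1 h2
  rw [h2, hdim, lintegral_const, one_mul] at h1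
  have h3 : ENNReal.ofReal (p.factorial / 2 : ℝ) ≠ 0 := by simp; positivity
  refine (ENNReal.mul_right_inj h3 ENNReal.ofReal_ne_top).1 ?_
  rw [← h1, ← ENNReal.ofReal_mul (by positivity)]
  congr 1
  push_cast
  rw [mul_div_cancel_left₀ _ two_ne_zero]
  norm_cast
  have : (p.factorial : ℝ) ≠ 0 := by positivity
  field_simp
  simp

/-- Even moments of a linear functional on the sphere. -/
theorem lintegral_sphere_inner_pow {p : ℕ} (hdim : Module.finrank ℝ E = 2 * (p + 1))
    (w : E) (k : ℕ) :
    ∫⁻ u, ENNReal.ofReal (inner ℝ w (u : E) ^ (2 * k)) ∂(volume : Measure E).toSphere =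
      (volume : Measure E).toSphere univ * ENNReal.ofReal ((2 * k).factorial *
        (p.factorial * ((‖w‖ / 2) ^ 2) ^ k / (k.factorial * (k + p).factorial))) := by
  have h1 := lintegral_homogeneous (E := E) hdim
    (g := fun y => ENNReal.ofReal (inner ℝ w y ^ (2 * k))) (by fun_prop) k
    (fun r hr x => by
      rw [inner_smul_right, mul_pow, ENNReal.ofReal_mul (by positivity)])
  have h2 := lintegral_inner_pow_mul_exp_neg_sq (E := E) (n := 2 * p + 1) (by omega) w k
  simp_rw [ENNReal.ofReal_mul ((even_two_mul k).pow_nonneg _)] at h2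
  rw [h2] at h1
  have h3 : ENNReal.ofReal ((p + k).factorial / 2 : ℝ) ≠ 0 := by simp; positivity
  refine (ENNReal.mul_right_inj h3 ENNReal.ofReal_ne_top).1 ?_
  rw [← h1, toSphere_univ_eq hdim, ← ENNReal.ofReal_mul (by positivity),
    ← ENNReal.ofReal_mul (by positivity),
    show 2 * p + 1 + 1 = 2 * (p + 1) by ring, pow_mul, Real.sq_sqrt Real.pi_pos.le, add_comm k p]
  congr 1
  have : (p.factorial : ℝ) ≠ 0 := by positivity
  have : (k.factorial : ℝ) ≠ 0 := by positivity
  have : ((p + k).factorial : ℝ) ≠ 0 := by positivity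
  rw [pow_mul, div_pow, div_pow, show (2 : ℝ) ^ 2 = 4 by norm_num]
  field_simp

/-- The surface measure is invariant under the antipodal map. -/
theorem lintegral_sphere_neg {p : ℕ} (hdim : Module.finrank ℝ E = 2 * (p + 1))
    {g : E → ℝ≥0∞} (hg : Measurable g) :
    ∫⁻ u, g (-(u : E)) ∂(volume : Measure E).toSphere =
      ∫⁻ u, g (u : E) ∂(volume : Measure E).toSphere := by
  -- Extend a function on the sphere to be homogeneous of degree zero, so that the invariance of
  -- the volume under `y ↦ -y` carries over to the sphere.
  have key : ∀ f : E → ℝ≥0∞, Measurable f →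
      ENNReal.ofReal ((p + 0).factorial / 2) * ∫⁻ u, f (u : E) ∂(volume : Measure E).toSphere =
      ∫⁻ y, f (‖y‖⁻¹ • y) * ENNReal.ofReal (Real.exp (-‖y‖ ^ 2)) := by
    intro f hf
    rw [lintegral_homogeneous (E := E) hdim (g := fun y => f (‖y‖⁻¹ • y)) (by fun_prop) 0
      (fun r hr x => by
        rw [norm_smul, Real.norm_of_nonneg hr.le, smul_smul]
        simp only [mul_zero, pow_zero, ENNReal.ofReal_one, one_mul]
        congr 2
        field_simp)]
    congr 1
    refine lintegral_congr fun u => ?_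
    rw [norm_eq_of_mem_sphere u]
    simp
  have h3 : ENNReal.ofReal ((p + 0).factorial / 2 : ℝ) ≠ 0 := by simp; positivity
  refine (ENNReal.mul_right_inj h3 ENNReal.ofReal_ne_top).1 ?_
  rw [key g hg, key (fun y => g (-y)) (by fun_prop), ← lintegral_neg_eq_self]
  simp

/-- The Laplace transform of the surface measure is a Bessel function. -/
theorem lintegral_sphere_exp_inner {p : ℕ} (hdim : Module.finrank ℝ E = 2 * (p + 1)) (w : E) :
    ∫⁻ u, ENNReal.ofReal (Real.exp (inner ℝ w (u : E))) ∂(volume : Measure E).toSphere =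
      (volume : Measure E).toSphere univ *
        ENNReal.ofReal (p.factorial * besselSeries p ((‖w‖ / 2) ^ 2)) := by
  have hsymm := lintegral_sphere_neg (E := E) hdim
    (g := fun y => ENNReal.ofReal (Real.exp (inner ℝ w y))) (by fun_prop)
  -- By symmetry only even moments contribute.
  have hcosh : ∫⁻ u, ENNReal.ofReal (Real.exp (inner ℝ w (u : E)))
      ∂(volume : Measure E).toSphere =
      ∫⁻ u, ENNReal.ofReal (Real.cosh (inner ℝ w (u : E))) ∂(volume : Measure E).toSphere := by
    refine (ENNReal.mul_right_inj (a := 2) (by simp) (by simp)).1 ?_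
    rw [two_mul]
    nth_rw 2 [← hsymm]
    rw [← lintegral_add_left (by fun_prop), ← lintegral_const_mul _ (by fun_prop)]
    refine lintegral_congr fun u => ?_
    rw [← ENNReal.ofReal_add (Real.exp_pos _).le (Real.exp_pos _).le, inner_neg_right,
      Real.cosh_eq, ← ENNReal.ofReal_ofNat, ← ENNReal.ofReal_mul (by simp)]
    congr 1
    ring
  have hser : ∀ x : ℝ, ENNReal.ofReal (Real.cosh x) =
      ∑' k : ℕ, ENNReal.ofReal (((2 * k).factorial : ℝ)⁻¹) * ENNReal.ofReal (x ^ (2 * k)) := by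
    intro x
    have h := Real.hasSum_cosh x
    rw [← h.tsum_eq, ENNReal.ofReal_tsum_of_nonneg _ h.summable]
    · refine tsum_congr fun k => ?_
      rw [← ENNReal.ofReal_mul (by positivity), div_eq_inv_mul]
    · intro k
      exact div_nonneg ((even_two_mul k).pow_nonneg x) (by positivity)
  rw [hcosh]
  simp_rw [hser]
  rw [lintegral_tsum fun k => by fun_prop]
  simp_rw [lintegral_const_mul' _ _ ENNReal.ofReal_ne_top, lintegral_sphere_inner_pow hdim w]
  rw [besselSeries, ← tsum_mul_left, ENNReal.ofReal_tsum_of_nonneg, ← ENNReal.tsum_mul_left]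
  · refine tsum_congr fun k => ?_
    rw [mul_left_comm, ← ENNReal.ofReal_mul (by positivity)]
    congr 2
    have : ((2 * k).factorial : ℝ) ≠ 0 := by positivity
    field_simp
  · intro k
    positivity
  · exact (summable_besselSeries p _).mul_left _

end Sphere

/-! ### The output density of one block -/

section Density

/-- Complex Gaussian laws are probability measures. -/
theorem isProbabilityMeasure_complexGaussian (m : ℂ) {v : ℝ} (hv : 0 < v) :
    IsProbabilityMeasure (complexGaussian m v) := by
  constructor
  rw [complexGaussian, withDensity_apply _ MeasurableSet.univ, setLIntegral_univ]
  have h := lintegral_exp_neg_mul_sq_add_inner (E := ℂ) (inv_pos.2 hv) 0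
  rw [← lintegral_sub_right_eq_self _ m] at h
  simp only [inner_zero_left, add_zero, Complex.finrank_real_complex, norm_zero] at h
  simp_rw [ENNReal.ofReal_mul (show 0 ≤ (Real.pi * v)⁻¹ by positivity)]
  rw [lintegral_const_mul' _ _ ENNReal.ofReal_ne_top]
  have : ∀ z : ℂ, -‖z - m‖ ^ 2 / v = -v⁻¹ * ‖z - m‖ ^ 2 := fun z => by ring
  simp_rw [this]
  rw [h, ← ENNReal.ofReal_mul (by positivity), ← ENNReal.ofReal_one]
  congr 1
  have := Real.pi_pos.ne'
  simp
  field_simp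

theorem noiseLaw_eq (n : ℕ) : noiseLaw n = (volume : Measure (Block n)).withDensity
    fun w => ENNReal.ofReal ((Real.pi ^ n)⁻¹ * Real.exp (-‖w‖ ^ 2)) := by
  have hm : Measurable (WithLp.toLp 2 : (Fin n → ℂ) → Block n) :=
    (PiLp.continuous_toLp 2 _).measurable
  have hpr := isProbabilityMeasure_complexGaussian 0 one_pos
  have h1 : (Measure.pi fun _ : Fin n => complexGaussian 0 1) =
      (Measure.pi fun _ : Fin n => (volume : Measure ℂ)).withDensity fun x =>
        ENNReal.ofReal ((Real.pi ^ n)⁻¹ * Real.exp (-‖(WithLp.toLp 2 x : Block n)‖ ^ 2)) := by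
    have hpr' : ∀ _ : Fin n, SigmaFinite ((volume : Measure ℂ).withDensity fun z =>
        ENNReal.ofReal ((Real.pi * 1)⁻¹ * Real.exp (-(‖z - 0‖ ^ 2) / 1))) := by
      intro _
      have : IsProbabilityMeasure ((volume : Measure ℂ).withDensity fun z =>
        ENNReal.ofReal ((Real.pi * 1)⁻¹ * Real.exp (-(‖z - 0‖ ^ 2) / 1))) := hpr
      infer_instance
    have := pi_withDensity (n := n) (fun _ => (volume : Measure ℂ)) (fun _ z =>
        ENNReal.ofReal ((Real.pi * 1)⁻¹ * Real.exp (-(‖z - 0‖ ^ 2) / 1))) (fun i => by fun_prop)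
    refine this.trans ?_
    congr 1
    ext x
    rw [← ENNReal.ofReal_prod_of_nonneg fun i _ => by positivity, Finset.prod_mul_distrib,
      ← Real.exp_sum, EuclideanSpace.norm_sq_eq]
    simp [Finset.sum_neg_distrib]
  rw [noiseLaw, h1, ← map_toLp_pi_volume]
  ext s hs
  rw [Measure.map_apply hm hs, withDensity_apply _ (hm hs), withDensity_apply _ hs,
    setLIntegral_map hs (by fun_prop) hm]

theorem isProbabilityMeasure_noiseLaw (n : ℕ) : IsProbabilityMeasure (noiseLaw n) := by
  have := isProbabilityMeasure_complexGaussian 0 one_pos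
  exact Measure.isProbabilityMeasure_map (PiLp.continuous_toLp 2 _).measurable.aemeasurable

variable {n : ℕ}

theorem measurable_blockMap (x : Block n) :
    Measurable fun p : ℂ × Block n => p.1 • x + p.2 := by fun_prop

theorem isProbabilityMeasure_blockLaw (μ : ℂ) {v : ℝ} (hv : 0 < v) (x : Block n) :
    IsProbabilityMeasure (blockLaw μ v x) := by
  have := isProbabilityMeasure_complexGaussian μ hv
  have := isProbabilityMeasure_noiseLaw n
  exact Measure.isProbabilityMeasure_map (measurable_blockMap x).aemeasurable

/-- Completing the square in the fading coefficient. -/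
theorem lintegral_fading (μ : ℂ) {v s : ℝ} (hv : 0 < v) (hs : 0 < s) (x y : Block n) :
    ∫⁻ h : ℂ, ENNReal.ofReal (Real.exp (-(s * (‖y - h • x‖ ^ 2 + ‖h - μ‖ ^ 2 / v)))) =
      ENNReal.ofReal (Real.pi / (s * (v⁻¹ + ‖x‖ ^ 2)) * Real.exp (-(s * (‖y‖ ^ 2 + ‖μ‖ ^ 2 / v -
        ‖inner ℂ x y + v⁻¹ • μ‖ ^ 2 / (v⁻¹ + ‖x‖ ^ 2))))) := by
  set w : ℂ := inner ℂ x y + v⁻¹ • μ with hw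
  have hc : 0 < v⁻¹ + ‖x‖ ^ 2 := by positivity
  have hexp : ∀ h : ℂ, -(s * (‖y - h • x‖ ^ 2 + ‖h - μ‖ ^ 2 / v)) =
      -(s * (‖y‖ ^ 2 + ‖μ‖ ^ 2 / v)) +
        (-(s * (v⁻¹ + ‖x‖ ^ 2)) * ‖h‖ ^ 2 + inner ℝ ((2 * s) • w) h) := by
    intro h
    have h1 : inner ℝ y (h • x) = inner ℝ (inner ℂ x y : ℂ) h := by
      rw [PiLp.inner_apply, PiLp.inner_apply, Complex.inner, map_sum, Finset.mul_sum,
        Complex.re_sum]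
      refine Finset.sum_congr rfl fun i _ => ?_
      simp [Complex.inner]
      ring
    rw [norm_sub_sq_real, norm_sub_sq_real, h1, norm_smul, hw, inner_smul_left, inner_add_left,
      inner_smul_left, real_inner_comm h μ]
    simp only [conj_trivial]
    field_simp
    ring
  simp_rw [hexp, Real.exp_add, ENNReal.ofReal_mul (Real.exp_pos _).le]
  rw [lintegral_const_mul' _ _ ENNReal.ofReal_ne_top]
  simp_rw [← ENNReal.ofReal_mul (Real.exp_pos _).le, ← Real.exp_add]
  rw [lintegral_exp_neg_mul_sq_add_inner (mul_pos hs hc), ← ENNReal.ofReal_mul (Real.exp_pos _).le]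
  congr 1
  rw [mul_left_comm, ← Real.exp_add, Complex.finrank_real_complex, norm_smul,
    Real.norm_of_nonneg (by positivity)]
  congr 1
  · simp
  · congr 1
    field_simp
    ring

/-- The exponent of the output density of one block. -/
noncomputable def blockExponent (μ : ℂ) (v : ℝ) (x y : Block n) : ℝ :=
  ‖y‖ ^ 2 + ‖μ‖ ^ 2 / v - ‖inner ℂ x y + v⁻¹ • μ‖ ^ 2 / (v⁻¹ + ‖x‖ ^ 2)

theorem lintegral_complexGaussian (μ : ℂ) {v : ℝ} (hv : 0 < v) (x y : Block n) :
    ∫⁻ h, ENNReal.ofReal ((Real.pi ^ n)⁻¹ * Real.exp (-(‖y - h • x‖ ^ 2))) ∂(complexGaussian μ v) =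
      ENNReal.ofReal ((Real.pi ^ n * (1 + v * ‖x‖ ^ 2))⁻¹ *
        Real.exp (-blockExponent μ v x y)) := by
  rw [complexGaussian, lintegral_withDensity_eq_lintegral_mul _ (by fun_prop) (by fun_prop)]
  have h1 : ∀ h : ℂ, ((fun z : ℂ => ENNReal.ofReal ((Real.pi * v)⁻¹ *
      Real.exp (-(‖z - μ‖ ^ 2) / v))) * fun h : ℂ => ENNReal.ofReal ((Real.pi ^ n)⁻¹ *
      Real.exp (-(‖y - h • x‖ ^ 2)))) h = ENNReal.ofReal ((Real.pi * v)⁻¹ * (Real.pi ^ n)⁻¹) *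
      ENNReal.ofReal (Real.exp (-(1 * (‖y - h • x‖ ^ 2 + ‖h - μ‖ ^ 2 / v)))) := by
    intro h
    rw [Pi.mul_apply, ← ENNReal.ofReal_mul (by positivity), ← ENNReal.ofReal_mul (by positivity)]
    congr 1
    rw [mul_mul_mul_comm, ← Real.exp_add]
    congr 2
    ring
  simp_rw [h1]
  rw [lintegral_const_mul' _ _ ENNReal.ofReal_ne_top, lintegral_fading μ hv one_pos,
    ← ENNReal.ofReal_mul (by positivity), ← mul_assoc, one_mul, one_mul]
  congr 2
  have := Real.pi_pos.ne'
  have : v⁻¹ + ‖x‖ ^ 2 ≠ 0 := by positivity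
  have : 1 + v * ‖x‖ ^ 2 ≠ 0 := by positivity
  rw [show v⁻¹ + ‖x‖ ^ 2 = (1 + v * ‖x‖ ^ 2) / v by field_simp]
  field_simp

theorem blockDensity_eq (μ : ℂ) {v : ℝ} (hv : 0 < v) (x y : Block n) :
    blockDensity μ v x y = (Real.pi ^ n * (1 + v * ‖x‖ ^ 2))⁻¹ *
        Real.exp (-blockExponent μ v x y) := by
  rw [blockDensity, integral_eq_lintegral_of_nonneg_ae (Filter.Eventually.of_forall fun h => by
    positivity) (Measurable.aestronglyMeasurable (by fun_prop)), lintegral_complexGaussian μ hv,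
    ENNReal.toReal_ofReal (by positivity)]

theorem blockDensity_pos (μ : ℂ) {v : ℝ} (hv : 0 < v) (x y : Block n) :
    0 < blockDensity μ v x y := by
  rw [blockDensity_eq μ hv]
  positivity

theorem blockDensity_le_one (μ : ℂ) {v : ℝ} (hv : 0 < v) (x y : Block n) :
    blockDensity μ v x y ≤ 1 := by
  have := isProbabilityMeasure_complexGaussian μ hv
  have h : ENNReal.ofReal (blockDensity μ v x y) ≤ 1 := by
    rw [blockDensity_eq μ hv, ← lintegral_complexGaussian μ hv]
    refine (lintegral_mono fun h => ?_).trans (by simp : ∫⁻ _, 1 ∂(complexGaussian μ v) ≤ 1)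
    rw [← ENNReal.ofReal_one]
    refine ENNReal.ofReal_le_ofReal ?_
    have h1 : (Real.pi ^ n)⁻¹ ≤ 1 :=
      inv_le_one_of_one_le₀ (one_le_pow₀ (by linarith [Real.pi_gt_three]))
    have h2 : Real.exp (-(‖y - h • x‖ ^ 2)) ≤ 1 :=
      Real.exp_le_one_iff.2 (neg_nonpos.2 (by positivity))
    exact mul_le_one₀ h1 (Real.exp_pos _).le h2
  simpa using h

theorem continuous_blockDensity (μ : ℂ) {v : ℝ} (hv : 0 < v) :
    Continuous fun p : Block n × Block n => blockDensity μ v p.1 p.2 := by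
  simp_rw [blockDensity_eq μ hv, blockExponent]
  have h1 : ∀ p : Block n × Block n, Real.pi ^ n * (1 + v * ‖p.1‖ ^ 2) ≠ 0 := fun p => by positivity
  have h2 : ∀ p : Block n × Block n, v⁻¹ + ‖p.1‖ ^ 2 ≠ 0 := fun p => by positivity
  fun_prop (disch := assumption)

@[fun_prop]
theorem measurable_blockDensity (μ : ℂ) {v : ℝ} (hv : 0 < v) :
    Measurable fun p : Block n × Block n => blockDensity μ v p.1 p.2 :=
  (continuous_blockDensity μ hv).measurable

/-- The output law of one block has the density `blockDensity`. -/
theorem blockLaw_eq (μ : ℂ) {v : ℝ} (hv : 0 < v) (x : Block n) :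
    blockLaw μ v x = (volume : Measure (Block n)).withDensity
      fun y => ENNReal.ofReal (blockDensity μ v x y) := by
  have := isProbabilityMeasure_complexGaussian μ hv
  have := isProbabilityMeasure_noiseLaw n
  ext s hs
  rw [← lintegral_indicator_one hs, blockLaw, lintegral_map (measurable_one.indicator hs)
    (measurable_blockMap x), lintegral_prod (fun p : ℂ × Block n =>
    s.indicator (1 : Block n → ℝ≥0∞) (p.1 • x + p.2)) ((measurable_one.indicator hs).comp
    (measurable_blockMap x)).aemeasurable]
  have h1 : ∀ h : ℂ, ∫⁻ w, s.indicator (1 : Block n → ℝ≥0∞) (h • x + w) ∂(noiseLaw n) =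
      ∫⁻ y, ENNReal.ofReal ((Real.pi ^ n)⁻¹ * Real.exp (-(‖y - h • x‖ ^ 2))) * s.indicator 1 y := by
    intro h
    have hg : Measurable fun w => s.indicator (1 : Block n → ℝ≥0∞) (h • x + w) :=
      (measurable_one.indicator hs).comp (measurable_const_add _)
    rw [noiseLaw_eq, lintegral_withDensity_eq_lintegral_mul _ (by fun_prop) hg,
      ← lintegral_sub_right_eq_self _ (h • x)]
    simp
  simp_rw [h1]
  rw [lintegral_lintegral_swap, withDensity_apply _ hs, ← lintegral_indicator hs]
  · refine lintegral_congr fun y => ?_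
    rw [lintegral_mul_const _ (by fun_prop), lintegral_complexGaussian μ hv,
      ← blockDensity_eq μ hv]
    by_cases hy : y ∈ s <;> simp [hy]
  · refine Measurable.aemeasurable (Measurable.mul (by fun_prop) ?_)
    exact (measurable_one.indicator hs).comp measurable_snd

/-- The powers of the density are themselves Gaussian mixtures over the fading coefficient. -/
theorem ofReal_blockDensity_rpow (μ : ℂ) {v s : ℝ} (hv : 0 < v) (hs : 0 < s) (x y : Block n) :
    ENNReal.ofReal (blockDensity μ v x y ^ s) =
      ENNReal.ofReal (((Real.pi ^ n * (1 + v * ‖x‖ ^ 2))⁻¹) ^ s *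
        (s * (v⁻¹ + ‖x‖ ^ 2) / Real.pi)) *
      ∫⁻ h : ℂ, ENNReal.ofReal (Real.exp (-(s * (‖y - h • x‖ ^ 2 + ‖h - μ‖ ^ 2 / v)))) := by
  rw [lintegral_fading μ hv hs, ← ENNReal.ofReal_mul (by positivity), blockDensity_eq μ hv,
    Real.mul_rpow (by positivity) (Real.exp_pos _).le, ← Real.exp_mul, mul_assoc, ← mul_assoc _ _
    (Real.exp _), ← blockExponent]
  congr 2
  have := Real.pi_pos.ne'
  have : v⁻¹ + ‖x‖ ^ 2 ≠ 0 := by positivity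
  rw [show s * (v⁻¹ + ‖x‖ ^ 2) / Real.pi * (Real.pi / (s * (v⁻¹ + ‖x‖ ^ 2))) = 1 by field_simp,
    one_mul]
  congr 1
  ring

end Density

/-! ### The shell distribution -/

theorem nontrivial_block {n : ℕ} (hn : 1 ≤ n) : Nontrivial (Block n) :=
  Module.nontrivial_of_finrank_pos (R := ℝ) (by rw [finrank_block]; omega)

theorem toSphere_block_univ_ne_zero {n : ℕ} (hn : 1 ≤ n) :
    (volume : Measure (Block n)).toSphere univ ≠ 0 := by
  have := nontrivial_block hn
  exact Measure.measure_univ_ne_zero.2 (Measure.toSphere_ne_zero (volume : Measure (Block n)))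

theorem lintegral_shellLaw (n : ℕ) (ρ : ℝ) {f : Block n → ℝ≥0∞} (hf : Measurable f) :
    ∫⁻ x, f x ∂(shellLaw n ρ) = ((volume : Measure (Block n)).toSphere univ)⁻¹ *
      ∫⁻ u, f (Real.sqrt (n * ρ) • (u : Block n)) ∂(volume : Measure (Block n)).toSphere := by
  rw [shellLaw, lintegral_map hf (by fun_prop), lintegral_smul_measure, smul_eq_mul]

theorem isProbabilityMeasure_shellLaw {n : ℕ} (hn : 1 ≤ n) (ρ : ℝ) :
    IsProbabilityMeasure (shellLaw n ρ) := by
  constructor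
  have h := lintegral_shellLaw n ρ (f := fun _ => 1) measurable_const
  simp only [lintegral_const, one_mul] at h
  rw [h, ENNReal.inv_mul_cancel (toSphere_block_univ_ne_zero hn) (measure_ne_top _ _)]

theorem ae_shellLaw_norm_sq (n : ℕ) {ρ : ℝ} (hρ : 0 < ρ) :
    ∀ᵐ x ∂(shellLaw n ρ), ‖x‖ ^ 2 = n * ρ := by
  rw [shellLaw, ae_map_iff (by fun_prop) (measurableSet_eq_fun (by fun_prop) (by fun_prop))]
  refine Filter.Eventually.of_forall fun u => ?_
  rw [norm_smul, norm_eq_of_mem_sphere u, mul_one, Real.norm_eq_abs, sq_abs,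
    Real.sq_sqrt (by positivity)]

/-- The Laplace transform of the shell distribution. -/
theorem lintegral_shellLaw_exp_inner (p : ℕ) {ρ : ℝ} (hρ : 0 < ρ) (w : Block (p + 1)) :
    ∫⁻ x, ENNReal.ofReal (Real.exp (inner ℝ w x)) ∂(shellLaw (p + 1) ρ) =
      ENNReal.ofReal (p.factorial * besselSeries p ((p + 1 : ℕ) * ρ * (‖w‖ / 2) ^ 2)) := by
  have := nontrivial_block (n := p + 1) (by omega)
  rw [lintegral_shellLaw _ _ (by fun_prop)]
  have : ∀ u : Block (p + 1), inner ℝ w (Real.sqrt ((p + 1 : ℕ) * ρ) • u) =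
      inner ℝ (Real.sqrt ((p + 1 : ℕ) * ρ) • w) u := fun u => by
    rw [inner_smul_left, inner_smul_right]; rfl
  simp_rw [this]
  rw [lintegral_sphere_exp_inner (finrank_block _), ← mul_assoc,
    ENNReal.inv_mul_cancel (toSphere_block_univ_ne_zero (by omega)) (measure_ne_top _ _), one_mul,
    norm_smul, Real.norm_of_nonneg (Real.sqrt_nonneg _), mul_div_assoc, mul_pow,
    Real.sq_sqrt (by positivity)]

/-- Integration over the phase of a complex variable produces the Bessel function of order zero. -/
theorem lintegral_complex_radial_mul_exp_inner {F : ℝ → ℝ≥0∞} (hF : Measurable F) (w : ℂ) :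
    ∫⁻ h : ℂ, F (‖h‖ ^ 2) * ENNReal.ofReal (Real.exp (inner ℝ w h)) =
      ∫⁻ z in Ioi (0 : ℝ), F z * ENNReal.ofReal (Real.pi * besselSeries 0 (z * (‖w‖ / 2) ^ 2)) := by
  have hdim : Module.finrank ℝ ℂ = 2 * (0 + 1) := by simp
  rw [lintegral_polar volume (n := 1) le_rfl (by simp) (by fun_prop)]
  refine setLIntegral_congr_fun measurableSet_Ioi fun z hz => ?_
  have hz : 0 < z := hz
  have h1 : ∀ u : Metric.sphere (0 : ℂ) 1, F (‖Real.sqrt z • (u : ℂ)‖ ^ 2) *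
      ENNReal.ofReal (Real.exp (inner ℝ w (Real.sqrt z • (u : ℂ)))) =
      F z * ENNReal.ofReal (Real.exp (inner ℝ (Real.sqrt z • w) (u : ℂ))) := by
    intro u
    rw [norm_smul, norm_eq_of_mem_sphere u, mul_one, Real.norm_eq_abs, sq_abs,
      Real.sq_sqrt hz.le, inner_smul_right, inner_smul_left]
    rfl
  simp_rw [h1]
  rw [lintegral_const_mul _ (by fun_prop), lintegral_sphere_exp_inner hdim,
    toSphere_univ_eq hdim, ← ENNReal.ofReal_mul (by positivity), mul_left_comm,
    ← ENNReal.ofReal_mul (by positivity), norm_smul, Real.norm_of_nonneg (Real.sqrt_nonneg _),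
    mul_div_assoc (Real.sqrt z), mul_pow, Real.sq_sqrt hz.le]
  congr 2
  simp
  ring

/-- The mean `E[P(y|X) ^ t]` of a power of the likelihood of the output `y`, for an input `X` drawn
from the shell. -/
noncomputable def shellPower {n : ℕ} (μ : ℂ) (v ρ t : ℝ) (y : Block n) : ℝ≥0∞ :=
  ∫⁻ x, ENNReal.ofReal (blockDensity μ v x y ^ t) ∂(shellLaw n ρ)

/-- The mean of a power of the likelihood, expanded as a mixture over the fading power `z`. -/
theorem shellPower_eq_besselSeries (p : ℕ) (μ : ℂ) {v ρ s : ℝ} (hv : 0 < v) (hρ : 0 < ρ)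
    (hs : 0 < s) (y : Block (p + 1)) :
    shellPower μ v ρ s y = ENNReal.ofReal (((Real.pi ^ (p + 1) *
        (1 + v * ((p + 1 : ℕ) * ρ)))⁻¹) ^ s * (s * (v⁻¹ + (p + 1 : ℕ) * ρ)) * p.factorial *
        Real.exp (-(s * (‖y‖ ^ 2 + ‖μ‖ ^ 2 / v)))) *
      ∫⁻ z in Ioi (0 : ℝ), ENNReal.ofReal (Real.exp (-(s * (v⁻¹ + (p + 1 : ℕ) * ρ) * z)) *
        besselSeries p (s ^ 2 * ((p + 1 : ℕ) * ρ * ‖y‖ ^ 2 * z)) *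
        besselSeries 0 (z * (s * ‖μ‖ / v) ^ 2)) := by
  have := isProbabilityMeasure_shellLaw (n := p + 1) (by omega) ρ
  set B : ℝ := (p + 1 : ℕ) * ρ with hB
  have hB0 : 0 < B := by positivity
  have h1 : shellPower μ v ρ s y = ∫⁻ x, ENNReal.ofReal (((Real.pi ^ (p + 1) *
        (1 + v * B))⁻¹) ^ s * (s * (v⁻¹ + B) / Real.pi)) *
      (∫⁻ h : ℂ, ENNReal.ofReal (Real.exp (-(s * (‖y‖ ^ 2 + ‖h‖ ^ 2 * B + ‖h - μ‖ ^ 2 / v)))) *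
        ENNReal.ofReal (Real.exp (inner ℝ ((2 * s) • (starRingEnd ℂ h • y)) x)))
        ∂(shellLaw (p + 1) ρ) := by
    refine lintegral_congr_ae ?_
    filter_upwards [ae_shellLaw_norm_sq (p + 1) hρ] with x hx
    rw [ofReal_blockDensity_rpow μ hv hs, hx]
    congr 1
    refine lintegral_congr fun h => ?_
    rw [← ENNReal.ofReal_mul (Real.exp_pos _).le, ← Real.exp_add]
    congr 2
    have h2 : inner ℝ y (h • x) = inner ℝ (starRingEnd ℂ h • y) x := by
      rw [PiLp.inner_apply, PiLp.inner_apply]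
      refine Finset.sum_congr rfl fun i _ => ?_
      simp [Complex.inner]
      ring
    rw [norm_sub_sq_real, h2, norm_smul, mul_pow, hx, inner_smul_left]
    simp only [conj_trivial]
    ring
  rw [h1, lintegral_const_mul' _ _ ENNReal.ofReal_ne_top, lintegral_lintegral_swap
    (Measurable.aemeasurable (by fun_prop))]
  -- The mean over the shell at a fixed fading coefficient.
  have h3 : ∀ h : ℂ, ∫⁻ x, ENNReal.ofReal (Real.exp (-(s * (‖y‖ ^ 2 + ‖h‖ ^ 2 * B +
      ‖h - μ‖ ^ 2 / v)))) * ENNReal.ofReal (Real.exp (inner ℝ ((2 * s) • (starRingEnd ℂ h • y)) x))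
      ∂(shellLaw (p + 1) ρ) =
      ENNReal.ofReal (p.factorial * Real.exp (-(s * (‖y‖ ^ 2 + ‖μ‖ ^ 2 / v)))) *
      ((fun z => ENNReal.ofReal (Real.exp (-(s * (v⁻¹ + B) * z)) *
        besselSeries p (s ^ 2 * (B * ‖y‖ ^ 2 * z)))) (‖h‖ ^ 2) *
        ENNReal.ofReal (Real.exp (inner ℝ ((2 * s / v) • μ) h))) := by
    intro h
    have hb : 0 ≤ besselSeries p (s ^ 2 * (B * ‖y‖ ^ 2 * ‖h‖ ^ 2)) :=
      besselSeries_nonneg p (by positivity)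
    rw [lintegral_const_mul' _ _ ENNReal.ofReal_ne_top, lintegral_shellLaw_exp_inner p hρ, ← hB,
      ← ENNReal.ofReal_mul (Real.exp_pos _).le, ← ENNReal.ofReal_mul (by positivity),
      ← ENNReal.ofReal_mul (by positivity), norm_smul, norm_smul,
      Real.norm_of_nonneg (by positivity),
      RCLike.norm_conj,
      show B * (2 * s * (‖h‖ * ‖y‖) / 2) ^ 2 = s ^ 2 * (B * ‖y‖ ^ 2 * ‖h‖ ^ 2) by ring]
    congr 1
    have h4 : Real.exp (-(s * (‖y‖ ^ 2 + ‖h‖ ^ 2 * B + ‖h - μ‖ ^ 2 / v))) =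
        Real.exp (-(s * (‖y‖ ^ 2 + ‖μ‖ ^ 2 / v))) * (Real.exp (-(s * (v⁻¹ + B) * ‖h‖ ^ 2)) *
          Real.exp (inner ℝ ((2 * s / v) • μ) h)) := by
      rw [← Real.exp_add, ← Real.exp_add, norm_sub_sq_real, inner_smul_left, real_inner_comm h μ]
      simp only [conj_trivial]
      congr 1
      field_simp
      ring
    rw [h4]
    ring
  simp_rw [h3]
  have hmeas := measurable_besselSeries p
  rw [lintegral_const_mul' _ _ ENNReal.ofReal_ne_top,
    lintegral_complex_radial_mul_exp_inner (F := fun z => ENNReal.ofReal (Real.exp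
      (-(s * (v⁻¹ + B) * z)) * besselSeries p (s ^ 2 * (B * ‖y‖ ^ 2 * z)))) (by fun_prop),
    ← mul_assoc, ← ENNReal.ofReal_mul (by positivity)]
  -- The factor `π` comes from the phase of the fading coefficient.
  have h5 : ∀ z ∈ Ioi (0 : ℝ), ENNReal.ofReal (Real.exp (-(s * (v⁻¹ + B) * z)) *
        besselSeries p (s ^ 2 * (B * ‖y‖ ^ 2 * z))) *
        ENNReal.ofReal (Real.pi * besselSeries 0 (z * (‖(2 * s / v) • μ‖ / 2) ^ 2)) =
      ENNReal.ofReal Real.pi * ENNReal.ofReal (Real.exp (-(s * (v⁻¹ + B) * z)) *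
        besselSeries p (s ^ 2 * (B * ‖y‖ ^ 2 * z)) * besselSeries 0 (z * (s * ‖μ‖ / v) ^ 2)) := by
    intro z hz
    have hz : 0 < z := hz
    have hb := besselSeries_nonneg p (q := s ^ 2 * (B * ‖y‖ ^ 2 * z)) (by positivity)
    rw [← ENNReal.ofReal_mul (by positivity), ← ENNReal.ofReal_mul Real.pi_pos.le, norm_smul,
      Real.norm_of_nonneg (by positivity), show 2 * s / v * ‖μ‖ / 2 = s * ‖μ‖ / v by ring]
    congr 1
    ring
  rw [setLIntegral_congr_fun measurableSet_Ioi h5, lintegral_const_mul' _ _ ENNReal.ofReal_ne_top,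
    ← mul_assoc, ← ENNReal.ofReal_mul (by positivity)]
  congr 2
  have := Real.pi_pos.ne'
  field_simp

/-! ### Gallager's integral and the explicit formula -/

section ShellPower

variable {n : ℕ} (μ : ℂ) {v ρ : ℝ}

theorem measurable_blockDensity_left (hv : 0 < v) (y : Block n) :
    Measurable fun x : Block n => blockDensity μ v x y :=
  Measurable.comp (g := fun p : Block n × Block n => blockDensity μ v p.1 p.2)
    (f := fun x : Block n => (x, y)) (measurable_blockDensity μ hv) (by fun_prop)

theorem measurable_blockDensity_right (hv : 0 < v) (x : Block n) :
    Measurable fun y : Block n => blockDensity μ v x y :=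
  Measurable.comp (g := fun p : Block n × Block n => blockDensity μ v p.1 p.2)
    (f := fun y : Block n => (x, y)) (measurable_blockDensity μ hv) (by fun_prop)

theorem measurable_shellPower (hn : 1 ≤ n) (hv : 0 < v) (t : ℝ) :
    Measurable (shellPower (n := n) μ v ρ t) := by
  have := isProbabilityMeasure_shellLaw hn ρ
  have h := measurable_blockDensity (n := n) μ hv
  exact Measurable.lintegral_prod_left
    (f := fun x y : Block n => ENNReal.ofReal (blockDensity μ v x y ^ t))
    ((h.pow_const t).ennreal_ofReal)

theorem shellPower_le_one (hn : 1 ≤ n) (hv : 0 < v) {t : ℝ} (ht : 0 ≤ t) (y : Block n) :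
    shellPower μ v ρ t y ≤ 1 := by
  have := isProbabilityMeasure_shellLaw hn ρ
  refine (lintegral_mono fun x => ?_).trans (by simp : ∫⁻ _, 1 ∂(shellLaw n ρ) ≤ 1)
  rw [← ENNReal.ofReal_one]
  exact ENNReal.ofReal_le_ofReal (Real.rpow_le_one (blockDensity_pos μ hv x y).le
    (blockDensity_le_one μ hv x y) ht)

theorem shellPower_pos (hn : 1 ≤ n) (hv : 0 < v) (t : ℝ) (y : Block n) :
    0 < shellPower μ v ρ t y := by
  have := isProbabilityMeasure_shellLaw hn ρ
  have h := measurable_blockDensity_left μ hv y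
  rw [shellPower, lintegral_pos_iff_support ((h.pow_const t).ennreal_ofReal)]
  have : (Function.support fun x => ENNReal.ofReal (blockDensity μ v x y ^ t)) = univ := by
    ext x
    simp [Real.rpow_pos_of_pos (blockDensity_pos μ hv x y) t]
  rw [this, measure_univ]
  exact one_pos

theorem lintegral_shellPower_one (hn : 1 ≤ n) (hv : 0 < v) :
    ∫⁻ y, shellPower (n := n) μ v ρ 1 y = 1 := by
  have := isProbabilityMeasure_shellLaw hn ρ
  have h := measurable_blockDensity (n := n) μ hv
  simp_rw [shellPower, Real.rpow_one]
  rw [lintegral_lintegral_swap (h.comp measurable_swap).ennreal_ofReal.aemeasurable]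
  have h1 : ∀ x : Block n, ∫⁻ y, ENNReal.ofReal (blockDensity μ v x y) = 1 := by
    intro x
    have := isProbabilityMeasure_blockLaw μ hv x
    rw [← setLIntegral_univ, ← withDensity_apply _ MeasurableSet.univ, ← blockLaw_eq μ hv,
      measure_univ]
  simp [h1]

/-- Monotonicity of the power means. -/
theorem shellPower_rpow_le (hn : 1 ≤ n) (hv : 0 < v) {τ : ℝ} (hτ : 0 ≤ τ) (y : Block n) :
    shellPower μ v ρ (1 / (1 + τ)) y ^ (1 + τ) ≤ shellPower μ v ρ 1 y := by
  have := isProbabilityMeasure_shellLaw hn ρ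
  have h := measurable_blockDensity_left μ hv y
  have h1 : 0 < 1 + τ := by linarith
  have hj := lintegral_rpow_le (P := shellLaw n ρ) h.ennreal_ofReal (τ := 1 / (1 + τ))
    (by positivity) (by rw [div_le_one h1]; linarith)
  have h2 : shellPower μ v ρ (1 / (1 + τ)) y ≤ shellPower μ v ρ 1 y ^ (1 / (1 + τ)) := by
    refine le_trans (le_of_eq ?_) (hj.trans (le_of_eq ?_))
    · refine lintegral_congr fun x => ?_
      rw [ENNReal.ofReal_rpow_of_pos (blockDensity_pos μ hv x y)]
    · simp_rw [shellPower, Real.rpow_one]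
  calc _ ≤ (shellPower μ v ρ 1 y ^ (1 / (1 + τ))) ^ (1 + τ) := by gcongr
    _ = _ := by rw [← ENNReal.rpow_mul, one_div_mul_cancel h1.ne', ENNReal.rpow_one]

end ShellPower

/-- For `r, z > 0` the powers of `√(r ρ n z)` in the denominator of the integrand cancel the leading
power of the Bessel function. -/
theorem jIntegrand_eq (p : ℕ) (μ : ℂ) {v ρ r τ z : ℝ} (hv : 0 < v) (hρ : 0 < ρ) (hτ : 0 ≤ τ)
    (hr : 0 < r) (hz : 0 < z) :
    jIntegrand (p + 1) μ v ρ r τ z = (1 / (1 + τ)) ^ p *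
      (Real.exp (-(1 / (1 + τ) * (v⁻¹ + (p + 1 : ℕ) * ρ) * z)) *
        besselSeries p ((1 / (1 + τ)) ^ 2 * ((p + 1 : ℕ) * ρ * r * z)) *
        besselSeries 0 (z * (1 / (1 + τ) * ‖μ‖ / v) ^ 2)) := by
  have h1 : 0 < 1 + τ := by linarith
  set q : ℝ := r * ρ * (p + 1 : ℕ) * z with hq
  have hq0 : 0 < q := by positivity
  have hs := Real.sqrt_pos.2 hq0
  have e1 : 2 * Real.sqrt q / (1 + τ) = 2 * (1 / (1 + τ) * Real.sqrt q) := by ring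
  have e2 : 2 * ‖μ‖ * Real.sqrt z / (v * (1 + τ)) =
      2 * (1 / (1 + τ) * ‖μ‖ / v * Real.sqrt z) := by
    field_simp
  rw [jIntegrand, ← hq, Nat.add_sub_cancel, e1, e2, besselI_two_mul, besselI_two_mul, mul_pow,
    mul_pow, mul_pow _ (Real.sqrt z) 2, Real.sq_sqrt hq0.le, Real.sq_sqrt hz.le, pow_zero]
  have e3 : (p + 1 : ℕ) * ρ * r * z = q := by rw [hq]; ring
  rw [e3, mul_comm z]
  have e4 : -(1 / (1 + τ)) * (v⁻¹ + ρ * (p + 1 : ℕ)) * z =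
      -(1 / (1 + τ) * (v⁻¹ + (p + 1 : ℕ) * ρ) * z) := by ring
  rw [e4]
  field_simp

theorem jIntegrand_nonneg (p : ℕ) (μ : ℂ) {v ρ r τ z : ℝ} (hv : 0 < v) (hρ : 0 < ρ) (hτ : 0 ≤ τ)
    (hr : 0 < r) (hz : 0 < z) : 0 ≤ jIntegrand (p + 1) μ v ρ r τ z := by
  rw [jIntegrand_eq p μ hv hρ hτ hr hz]
  have h1 : 0 < 1 + τ := by linarith
  have := besselSeries_nonneg p (q := (1 / (1 + τ)) ^ 2 * ((p + 1 : ℕ) * ρ * r * z)) (by positivity)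
  have := besselSeries_nonneg 0 (q := z * (1 / (1 + τ) * ‖μ‖ / v) ^ 2) (by positivity)
  positivity

theorem measurable_besselI (ν : ℕ) : Measurable (besselI ν) := by
  have h : besselI ν = fun x => (x / 2) ^ ν * besselSeries ν ((x / 2) ^ 2) := by
    ext x
    rw [← besselI_two_mul, mul_div_cancel₀ _ two_ne_zero]
  have := measurable_besselSeries ν
  rw [h]
  fun_prop

theorem measurable_jIntegrand (n : ℕ) (μ : ℂ) (v ρ τ : ℝ) :
    Measurable fun p : ℝ × ℝ => jIntegrand n μ v ρ p.1 τ p.2 := by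
  have h0 := measurable_besselI 0
  have h1 := measurable_besselI (n - 1)
  unfold jIntegrand
  fun_prop

/-- The factor in front of `J` in the mean of the power `1 / (1 + τ)` of the likelihood, up to the
exponential in the energy of the output. -/
noncomputable def shellFactor (p : ℕ) (μ : ℂ) (v ρ τ : ℝ) : ℝ :=
  ((Real.pi ^ (p + 1) * (1 + v * ((p + 1 : ℕ) * ρ)))⁻¹) ^ (1 / (1 + τ)) *
    (1 / (1 + τ) * (v⁻¹ + (p + 1 : ℕ) * ρ)) * p.factorial * (1 + τ) ^ p *
    Real.exp (-(1 / (1 + τ) * (‖μ‖ ^ 2 / v)))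

theorem shellFactor_pos (p : ℕ) (μ : ℂ) {v ρ τ : ℝ} (hv : 0 < v) (hρ : 0 < ρ) (hτ : 0 ≤ τ) :
    0 < shellFactor p μ v ρ τ := by
  have h1 : 0 < 1 + τ := by linarith
  unfold shellFactor
  positivity

theorem shellPower_eq_lintegral_jIntegrand (p : ℕ) (μ : ℂ) {v ρ τ : ℝ} (hv : 0 < v) (hρ : 0 < ρ)
    (hτ : 0 ≤ τ) {y : Block (p + 1)} (hy : 0 < ‖y‖ ^ 2) :
    shellPower μ v ρ (1 / (1 + τ)) y =
      ENNReal.ofReal (shellFactor p μ v ρ τ * Real.exp (-(1 / (1 + τ) * ‖y‖ ^ 2))) *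
        ∫⁻ z in Ioi (0 : ℝ), ENNReal.ofReal (jIntegrand (p + 1) μ v ρ (‖y‖ ^ 2) τ z) := by
  have h1 : 0 < 1 + τ := by linarith
  rw [shellPower_eq_besselSeries p μ hv hρ (by positivity) y]
  have h2 : ∫⁻ z in Ioi (0 : ℝ), ENNReal.ofReal (jIntegrand (p + 1) μ v ρ (‖y‖ ^ 2) τ z) =
      ENNReal.ofReal ((1 / (1 + τ)) ^ p) * ∫⁻ z in Ioi (0 : ℝ), ENNReal.ofReal
        (Real.exp (-(1 / (1 + τ) * (v⁻¹ + (p + 1 : ℕ) * ρ) * z)) *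
        besselSeries p ((1 / (1 + τ)) ^ 2 * ((p + 1 : ℕ) * ρ * ‖y‖ ^ 2 * z)) *
        besselSeries 0 (z * (1 / (1 + τ) * ‖μ‖ / v) ^ 2)) := by
    rw [← lintegral_const_mul' _ _ ENNReal.ofReal_ne_top]
    refine setLIntegral_congr_fun measurableSet_Ioi fun z hz => ?_
    rw [jIntegrand_eq p μ hv hρ hτ hy hz, ENNReal.ofReal_mul (by positivity)]
  rw [h2]
  conv_rhs => rw [← mul_assoc, ← ENNReal.ofReal_mul (mul_nonneg
    (shellFactor_pos p μ hv hρ hτ).le (Real.exp_pos _).le)]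
  rw [shellFactor, mul_add (1 / (1 + τ)) (‖y‖ ^ 2), neg_add, Real.exp_add]
  congr 2
  have h3 : (1 + τ) ^ p * (1 / (1 + τ)) ^ p = 1 := by
    rw [← mul_pow, mul_one_div_cancel h1.ne', one_pow]
  generalize (1 / (1 + τ)) ^ p = a at h3
  generalize ((Real.pi ^ (p + 1) * (1 + v * ((p + 1 : ℕ) * ρ)))⁻¹) ^ (1 / (1 + τ)) = K
  linear_combination (-K * (1 / (1 + τ) * (v⁻¹ + (p + 1 : ℕ) * ρ)) * p.factorial *
    Real.exp (-(1 / (1 + τ) * ‖y‖ ^ 2)) * Real.exp (-(1 / (1 + τ) * (‖μ‖ ^ 2 / v)))) * h3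

theorem integrableOn_jIntegrand {n : ℕ} (hn : 1 ≤ n) (μ : ℂ) {v ρ τ r : ℝ} (hv : 0 < v)
    (hρ : 0 < ρ) (hτ : 0 ≤ τ) (hr : 0 < r) :
    IntegrableOn (jIntegrand n μ v ρ r τ) (Ioi 0) := by
  obtain ⟨p, rfl⟩ := Nat.exists_eq_add_of_le' hn
  have := nontrivial_block hn
  have h1 : 0 < 1 + τ := by linarith
  -- Every `r > 0` is the energy of some output, at which the mean of the power is finite.
  obtain ⟨y, hy⟩ := exists_norm_eq (Block (p + 1)) (Real.sqrt_nonneg r)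
  have hy2 : ‖y‖ ^ 2 = r := by rw [hy, Real.sq_sqrt hr.le]
  have h := shellPower_eq_lintegral_jIntegrand p μ hv hρ hτ (y := y) (by rw [hy2]; exact hr)
  have hle := shellPower_le_one (ρ := ρ) μ hn hv (t := 1 / (1 + τ)) (by positivity) y
  rw [h, hy2] at hle
  have hfin : ∫⁻ z in Ioi (0 : ℝ), ENNReal.ofReal (jIntegrand (p + 1) μ v ρ r τ z) < ∞ := by
    by_contra htop
    rw [not_lt, top_le_iff] at htop
    rw [htop, ENNReal.mul_top] at hle
    · simp at hle
    · have := shellFactor_pos p μ hv hρ hτ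
      simp only [ne_eq, ENNReal.ofReal_eq_zero, not_le]
      positivity
  have hm : Measurable (jIntegrand (p + 1) μ v ρ r τ) :=
    (measurable_jIntegrand (p + 1) μ v ρ τ).comp measurable_prodMk_left
  refine ⟨hm.aestronglyMeasurable, ?_⟩
  rw [hasFiniteIntegral_iff_ofReal]
  · exact hfin
  · refine (ae_restrict_iff' measurableSet_Ioi).2 (Filter.Eventually.of_forall fun z hz => ?_)
    exact jIntegrand_nonneg p μ hv hρ hτ hr hz

theorem jInt_nonneg (p : ℕ) (μ : ℂ) {v ρ r τ : ℝ} (hv : 0 < v) (hρ : 0 < ρ) (hτ : 0 ≤ τ)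
    (hr : 0 < r) : 0 ≤ jInt (p + 1) μ v ρ r τ :=
  setIntegral_nonneg measurableSet_Ioi fun _ hz => jIntegrand_nonneg p μ hv hρ hτ hr hz

theorem shellPower_eq_jInt (p : ℕ) (μ : ℂ) {v ρ τ : ℝ} (hv : 0 < v) (hρ : 0 < ρ)
    (hτ : 0 ≤ τ) {y : Block (p + 1)} (hy : 0 < ‖y‖ ^ 2) :
    shellPower μ v ρ (1 / (1 + τ)) y =
      ENNReal.ofReal (shellFactor p μ v ρ τ * Real.exp (-(1 / (1 + τ) * ‖y‖ ^ 2)) *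
        jInt (p + 1) μ v ρ (‖y‖ ^ 2) τ) := by
  have := shellFactor_pos p μ hv hρ hτ
  rw [shellPower_eq_lintegral_jIntegrand p μ hv hρ hτ hy, jInt]
  conv_rhs => rw [ENNReal.ofReal_mul (by positivity),
    ofReal_integral_eq_lintegral_ofReal (integrableOn_jIntegrand (by omega) μ hv hρ hτ hy)
      ((ae_restrict_iff' measurableSet_Ioi).2 (Filter.Eventually.of_forall fun z hz =>
        jIntegrand_nonneg p μ hv hρ hτ hy hz))]

/-- The integral `∫ E[P(y|X) ^ (1 / (1 + τ))] ^ (1 + τ) dy`, whose negative logarithm is Gallager's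
function. -/
noncomputable def gallagerIntegral (n : ℕ) (μ : ℂ) (v ρ τ : ℝ) : ℝ≥0∞ :=
  ∫⁻ y : Block n, shellPower μ v ρ (1 / (1 + τ)) y ^ (1 + τ)

theorem gallagerIntegral_le_one {n : ℕ} (hn : 1 ≤ n) (μ : ℂ) {v ρ τ : ℝ} (hv : 0 < v)
    (hτ : 0 ≤ τ) : gallagerIntegral n μ v ρ τ ≤ 1 := by
  rw [← lintegral_shellPower_one (ρ := ρ) μ hn hv]
  exact lintegral_mono fun y => shellPower_rpow_le μ hn hv hτ y

theorem gallagerIntegral_pos {n : ℕ} (hn : 1 ≤ n) (μ : ℂ) {v ρ τ : ℝ} (hv : 0 < v)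
    (hτ : 0 ≤ τ) : 0 < gallagerIntegral n μ v ρ τ := by
  rw [gallagerIntegral, lintegral_pos_iff_support ((measurable_shellPower μ hn hv _).pow_const _)]
  have h1 : 0 < 1 + τ := by linarith
  have : (Function.support fun y : Block n => shellPower μ v ρ (1 / (1 + τ)) y ^ (1 + τ)) =
      univ := by
    ext y
    simp only [Function.mem_support, mem_univ, iff_true]
    exact (ENNReal.rpow_pos (shellPower_pos μ hn hv _ y)
      (ne_top_of_le_ne_top ENNReal.one_ne_top (shellPower_le_one μ hn hv (by positivity) y))).ne'
  rw [this]
  exact isOpen_univ.measure_pos volume univ_nonempty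

/-- The constants produced by the shell, the fading and the volume of the output space add up to
`c(τ)`. -/
theorem cConst_eq (p : ℕ) (μ : ℂ) {v ρ τ : ℝ} (hv : 0 < v) (hρ : 0 < ρ) (hτ : 0 ≤ τ) :
    cConst (p + 1) μ v ρ τ =
      Real.pi ^ (p + 1) / p.factorial * shellFactor p μ v ρ τ ^ (1 + τ) := by
  have h1 : 0 < 1 + τ := by linarith
  have hpi := Real.pi_pos
  have hD : 0 < 1 + v * ((p + 1 : ℕ) * ρ) := by positivity
  have hf : (0 : ℝ) < p.factorial := by positivity
  set D := 1 + v * ((p + 1 : ℕ) * ρ) with hDdef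
  have hc : v⁻¹ + (p + 1 : ℕ) * ρ = D / v := by rw [hDdef]; field_simp
  have hE : shellFactor p μ v ρ τ = ((Real.pi ^ (p + 1) * D)⁻¹) ^ (1 / (1 + τ)) *
      (D * p.factorial * ((1 + τ) ^ (((p + 1 : ℕ) : ℝ) - 2) / v)) *
      Real.exp (-(‖μ‖ ^ 2) / v) ^ (1 / (1 + τ)) := by
    rw [shellFactor, ← hDdef, hc, ← Real.exp_mul]
    have : (1 + τ) ^ (((p + 1 : ℕ) : ℝ) - 2) = (1 + τ) ^ p / (1 + τ) := by
      rw [show (((p + 1 : ℕ) : ℝ) - 2) = (p : ℝ) - 1 by push_cast; ring, Real.rpow_sub h1,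
        Real.rpow_natCast, Real.rpow_one]
    rw [this, show -(1 / (1 + τ) * (‖μ‖ ^ 2 / v)) = -(‖μ‖ ^ 2) / v * (1 / (1 + τ)) by ring]
    generalize ((Real.pi ^ (p + 1) * D)⁻¹) ^ (1 / (1 + τ)) = K
    field_simp
  have hg : Real.Gamma ((p + 1 : ℕ) : ℝ) = p.factorial := by
    push_cast
    exact Real.Gamma_nat_eq_factorial p
  rw [hE, Real.mul_rpow (by positivity) (by positivity), Real.mul_rpow (by positivity)
    (by positivity), ← Real.rpow_mul (by positivity), ← Real.rpow_mul (by positivity),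
    one_div_mul_cancel h1.ne', Real.rpow_one, Real.rpow_one, Real.mul_rpow (by positivity)
    (by positivity), Real.mul_rpow hD.le hf.le, cConst, hg, Real.rpow_add hD, Real.rpow_add hf,
    Real.rpow_one, Real.rpow_one, show 1 + v * ρ * (p + 1 : ℕ) = D by rw [hDdef]; ring]
  field_simp

/-- Gallager's integral in polar coordinates of the output space. -/
theorem gallagerIntegral_eq_lintegral (p : ℕ) (μ : ℂ) {v ρ τ : ℝ} (hv : 0 < v) (hρ : 0 < ρ)
    (hτ : 0 ≤ τ) : gallagerIntegral (p + 1) μ v ρ τ =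
      ENNReal.ofReal (cConst (p + 1) μ v ρ τ) *
        ∫⁻ r in Ioi (0 : ℝ), ENNReal.ofReal (e0Integrand (p + 1) μ v ρ τ r) := by
  have hn : 1 ≤ p + 1 := by omega
  have := nontrivial_block hn
  have h1 : 0 < 1 + τ := by linarith
  have hF := shellFactor_pos p μ hv hρ hτ
  rw [gallagerIntegral, lintegral_polar volume hn (finrank_block _)
    ((measurable_shellPower μ hn hv _).pow_const _), cConst_eq p μ hv hρ hτ,
    ← lintegral_const_mul' _ _ ENNReal.ofReal_ne_top]
  refine setLIntegral_congr_fun measurableSet_Ioi fun r hr => ?_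
  have hr : 0 < r := hr
  have hJ := jInt_nonneg p μ hv hρ hτ hr
  have h2 : ∀ u : Metric.sphere (0 : Block (p + 1)) 1,
      shellPower μ v ρ (1 / (1 + τ)) (Real.sqrt r • (u : Block (p + 1))) ^ (1 + τ) =
      ENNReal.ofReal (shellFactor p μ v ρ τ ^ (1 + τ) * Real.exp (-r) *
        jInt (p + 1) μ v ρ r τ ^ (1 + τ)) := by
    intro u
    have hu : ‖Real.sqrt r • (u : Block (p + 1))‖ ^ 2 = r := by
      rw [norm_smul, norm_eq_of_mem_sphere u, mul_one, Real.norm_eq_abs, sq_abs,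
        Real.sq_sqrt hr.le]
    rw [shellPower_eq_jInt p μ hv hρ hτ (by rw [hu]; exact hr), hu,
      ENNReal.ofReal_rpow_of_nonneg (by positivity) h1.le, Real.mul_rpow (by positivity) hJ,
      Real.mul_rpow hF.le (Real.exp_pos _).le, ← Real.exp_mul]
    congr 4
    field_simp
  simp_rw [h2]
  rw [lintegral_const, toSphere_univ_eq (finrank_block _), ← ENNReal.ofReal_mul (by positivity),
    ← ENNReal.ofReal_mul (by positivity), ← ENNReal.ofReal_mul (by positivity)]
  congr 1
  rw [e0Integrand, Nat.add_sub_cancel]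
  ring

theorem cConst_pos {n : ℕ} (hn : 1 ≤ n) (μ : ℂ) {v ρ τ : ℝ} (hv : 0 < v) (hρ : 0 < ρ)
    (hτ : 0 ≤ τ) : 0 < cConst n μ v ρ τ := by
  have h1 : 0 < 1 + τ := by linarith
  have : 0 < Real.Gamma n := Real.Gamma_pos_of_pos (by exact_mod_cast hn)
  unfold cConst
  positivity

theorem e0Integrand_nonneg (p : ℕ) (μ : ℂ) {v ρ r τ : ℝ} (hv : 0 < v) (hρ : 0 < ρ) (hτ : 0 ≤ τ)
    (hr : 0 < r) : 0 ≤ e0Integrand (p + 1) μ v ρ τ r := by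
  have := jInt_nonneg p μ hv hρ hτ hr
  unfold e0Integrand
  positivity

theorem integrableOn_e0Integrand {n : ℕ} (hn : 1 ≤ n) (μ : ℂ) {v ρ τ : ℝ} (hv : 0 < v)
    (hρ : 0 < ρ) (hτ : 0 ≤ τ) : IntegrableOn (e0Integrand n μ v ρ τ) (Ioi 0) := by
  have hc := cConst_pos hn μ hv hρ hτ
  obtain ⟨p, rfl⟩ := Nat.exists_eq_add_of_le' hn
  have hJ : Measurable fun r => jInt (p + 1) μ v ρ r τ :=
    ((measurable_jIntegrand (p + 1) μ v ρ τ).stronglyMeasurable.integral_prod_right').measurable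
  have hm : Measurable (e0Integrand (p + 1) μ v ρ τ) := by
    unfold e0Integrand
    fun_prop
  refine ⟨hm.aestronglyMeasurable, ?_⟩
  rw [hasFiniteIntegral_iff_ofReal]
  · have h := gallagerIntegral_le_one hn μ (ρ := ρ) hv hτ
    rw [gallagerIntegral_eq_lintegral p μ hv hρ hτ] at h
    by_contra htop
    rw [not_lt, top_le_iff] at htop
    rw [htop, ENNReal.mul_top (by simpa using hc)] at h
    simp at h
  · refine (ae_restrict_iff' measurableSet_Ioi).2 (Filter.Eventually.of_forall fun r hr => ?_)
    exact e0Integrand_nonneg p μ hv hρ hτ hr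

/-- The explicit function is the negative logarithm of Gallager's integral. -/
theorem gallagerIntegral_eq {n : ℕ} (hn : 1 ≤ n) (μ : ℂ) {v ρ τ : ℝ} (hv : 0 < v) (hρ : 0 < ρ)
    (hτ : 0 ≤ τ) : gallagerIntegral n μ v ρ τ = ENNReal.ofReal (Real.exp
      (-explicitE0 n μ v ρ τ)) := by
  have hc := cConst_pos hn μ hv hρ hτ
  have hi := integrableOn_e0Integrand hn μ hv hρ hτ
  have hpos := gallagerIntegral_pos (ρ := ρ) hn μ hv hτ
  have h : gallagerIntegral n μ v ρ τ = ENNReal.ofReal (cConst n μ v ρ τ *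
      ∫ r in Ioi (0 : ℝ), e0Integrand n μ v ρ τ r) := by
    obtain ⟨p, rfl⟩ := Nat.exists_eq_add_of_le' hn
    rw [gallagerIntegral_eq_lintegral p μ hv hρ hτ, ENNReal.ofReal_mul hc.le,
      ofReal_integral_eq_lintegral_ofReal hi]
    refine (ae_restrict_iff' measurableSet_Ioi).2 (Filter.Eventually.of_forall fun r hr => ?_)
    exact e0Integrand_nonneg p μ hv hρ hτ hr
  rw [h] at hpos ⊢
  rw [explicitE0, neg_neg, Real.exp_log (ENNReal.ofReal_pos.1 hpos)]

/-! ### Gallager's function: optimality of the parameter and continuity -/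

open Filter Topology

section Gallager

variable {n : ℕ} (μ : ℂ) {v ρ : ℝ}

theorem ofReal_integral_blockDensity_rpow (hn : 1 ≤ n) (hv : 0 < v) {s : ℝ} (hs : 0 ≤ s)
    (y : Block n) :
    ENNReal.ofReal (∫ x, blockDensity μ v x y ^ s ∂(shellLaw n ρ)) = shellPower μ v ρ s y := by
  have h := measurable_blockDensity_left μ hv y
  rw [integral_eq_lintegral_of_nonneg_ae (Eventually.of_forall fun x =>
    Real.rpow_nonneg (blockDensity_pos μ hv x y).le s) (h.pow_const s).aestronglyMeasurable,
    ENNReal.ofReal_toReal]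
  · rfl
  · exact ne_top_of_le_ne_top ENNReal.one_ne_top (shellPower_le_one μ hn hv hs y)

theorem ofReal_exp_neg_mul_infoDensity (hn : 1 ≤ n) (hv : 0 < v) {s : ℝ} (hs : 0 ≤ s) (τ : ℝ)
    (x y : Block n) :
    ENNReal.ofReal (Real.exp (-τ * infoDensity μ v ρ s x y)) =
      ENNReal.ofReal (blockDensity μ v x y ^ (-(s * τ))) * shellPower μ v ρ s y ^ τ := by
  have hP := blockDensity_pos μ hv x y
  have hS := ofReal_integral_blockDensity_rpow (ρ := ρ) μ hn hv hs y
  have hQ : 0 < ∫ x', blockDensity μ v x' y ^ s ∂(shellLaw n ρ) := by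
    rw [← ENNReal.ofReal_pos, hS]
    exact shellPower_pos μ hn hv s y
  rw [infoDensity, ← hS]
  generalize ∫ x', blockDensity μ v x' y ^ s ∂(shellLaw n ρ) = Q at hQ
  generalize blockDensity μ v x y = P at hP
  rw [ENNReal.ofReal_rpow_of_pos hQ, ← ENNReal.ofReal_mul (by positivity),
    mul_comm (-τ), ← Real.rpow_def_of_pos (by positivity), Real.div_rpow (by positivity) hQ.le,
    ← Real.rpow_mul hP.le, Real.rpow_neg hQ.le, div_inv_eq_mul, mul_neg]

/-- Gallager's function as an integral over the output space: the output density cancels one factor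
of the information density. -/
theorem gallagerE0_eq (hn : 1 ≤ n) (hv : 0 < v) {s : ℝ} (hs : 0 ≤ s) (τ : ℝ) :
    gallagerE0 n μ v ρ τ s = -ENNReal.log (∫⁻ y : Block n,
      shellPower μ v ρ s y ^ τ * shellPower μ v ρ (1 - s * τ) y) := by
  have := isProbabilityMeasure_shellLaw hn ρ
  have hP := measurable_blockDensity (n := n) μ hv
  have hS := measurable_shellPower (n := n) (ρ := ρ) μ hn hv s
  rw [gallagerE0]
  congr 2
  have h1 : ∀ x : Block n, ∫⁻ y, ENNReal.ofReal (Real.exp (-τ * infoDensity μ v ρ s x y))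
      ∂(blockLaw μ v x) = ∫⁻ y, shellPower μ v ρ s y ^ τ *
        ENNReal.ofReal (blockDensity μ v x y ^ (1 - s * τ)) := by
    intro x
    have hx := measurable_blockDensity_right μ hv x
    have hg : Measurable fun y : Block n => ENNReal.ofReal (blockDensity μ v x y ^ (-(s * τ))) *
        shellPower μ v ρ s y ^ τ := (hx.pow_const _).ennreal_ofReal.mul (hS.pow_const _)
    simp_rw [ofReal_exp_neg_mul_infoDensity μ hn hv hs]
    rw [blockLaw_eq μ hv, lintegral_withDensity_eq_lintegral_mul _ hx.ennreal_ofReal hg]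
    refine lintegral_congr fun y => ?_
    have hpos := blockDensity_pos μ hv x y
    rw [Pi.mul_apply, ← mul_assoc, ← ENNReal.ofReal_mul hpos.le, mul_comm, sub_eq_add_neg,
      Real.rpow_add hpos, Real.rpow_one]
  simp_rw [h1]
  have hm : Measurable (Function.uncurry fun x y : Block n => shellPower μ v ρ s y ^ τ *
      ENNReal.ofReal (blockDensity μ v x y ^ (1 - s * τ))) :=
    ((hS.comp measurable_snd).pow_const τ).mul (hP.pow_const _).ennreal_ofReal
  rw [lintegral_lintegral_swap hm.aemeasurable]
  refine lintegral_congr fun y => ?_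
  rw [lintegral_const_mul _ ((measurable_blockDensity_left μ hv y).pow_const _).ennreal_ofReal]
  rfl

theorem gallagerE0_one_div (hn : 1 ≤ n) (hv : 0 < v) {τ : ℝ} (hτ : 0 ≤ τ) :
    gallagerE0 n μ v ρ τ (1 / (1 + τ)) = -ENNReal.log (gallagerIntegral n μ v ρ τ) := by
  have h1 : 0 < 1 + τ := by linarith
  have h2 : 1 - 1 / (1 + τ) * τ = 1 / (1 + τ) := by field_simp; ring
  rw [gallagerE0_eq μ hn hv (by positivity), h2, gallagerIntegral]
  congr 2
  refine lintegral_congr fun y => ?_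
  rw [add_comm 1 τ, ENNReal.rpow_add_of_nonneg _ _ hτ zero_le_one, ENNReal.rpow_one]

/-- Hölder's inequality with exponents `1 + τ` and `(1 + τ) / τ` shows that `s = 1 / (1 + τ)`
minimizes the integral in Gallager's function, pointwise in the output. -/
theorem shellPower_rpow_le_mul (hv : 0 < v) {τ : ℝ} (hτ : 0 ≤ τ) (s : ℝ)
    (y : Block n) :
    shellPower μ v ρ (1 / (1 + τ)) y ^ (1 + τ) ≤
      shellPower μ v ρ s y ^ τ * shellPower μ v ρ (1 - s * τ) y := by
  have h1 : 0 < 1 + τ := by linarith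
  have hm := measurable_blockDensity_left μ hv y
  have h := ENNReal.lintegral_mul_norm_pow_le (μ := shellLaw n ρ)
    (hm.pow_const s).ennreal_ofReal.aemeasurable
    (hm.pow_const (1 - s * τ)).ennreal_ofReal.aemeasurable
    (p := τ / (1 + τ)) (q := 1 / (1 + τ)) (by positivity) (by positivity)
    (by rw [← add_div, add_comm τ, div_self h1.ne'])
  have h2 : ∀ x : Block n, ENNReal.ofReal (blockDensity μ v x y ^ s) ^ (τ / (1 + τ)) *
      ENNReal.ofReal (blockDensity μ v x y ^ (1 - s * τ)) ^ (1 / (1 + τ)) =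
      ENNReal.ofReal (blockDensity μ v x y ^ (1 / (1 + τ))) := by
    intro x
    have hP := blockDensity_pos μ hv x y
    rw [ENNReal.ofReal_rpow_of_pos (by positivity), ENNReal.ofReal_rpow_of_pos (by positivity),
      ← ENNReal.ofReal_mul (by positivity), ← Real.rpow_mul hP.le, ← Real.rpow_mul hP.le,
      ← Real.rpow_add hP]
    congr 2
    field_simp
    ring
  simp_rw [h2] at h
  calc shellPower μ v ρ (1 / (1 + τ)) y ^ (1 + τ)
      ≤ (shellPower μ v ρ s y ^ (τ / (1 + τ)) *
        shellPower μ v ρ (1 - s * τ) y ^ (1 / (1 + τ))) ^ (1 + τ) := by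
        gcongr
        exact h
    _ = _ := by
        rw [ENNReal.mul_rpow_of_nonneg _ _ h1.le, ← ENNReal.rpow_mul, ← ENNReal.rpow_mul,
          div_mul_cancel₀ _ h1.ne', div_mul_cancel₀ _ h1.ne', ENNReal.rpow_one]

theorem gallagerE0_le (hn : 1 ≤ n) (hv : 0 < v) {τ : ℝ} (hτ : 0 ≤ τ) {s : ℝ} (hs : 0 ≤ s) :
    gallagerE0 n μ v ρ τ s ≤ gallagerE0 n μ v ρ τ (1 / (1 + τ)) := by
  rw [gallagerE0_one_div μ hn hv hτ, gallagerE0_eq μ hn hv hs, EReal.neg_le_neg_iff]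
  exact ENNReal.log_monotone (lintegral_mono fun y => shellPower_rpow_le_mul μ hv hτ s y)

theorem gallagerE0_eq_explicitE0 (hn : 1 ≤ n) (hv : 0 < v) (hρ : 0 < ρ) {τ : ℝ} (hτ : 0 ≤ τ) :
    gallagerE0 n μ v ρ τ (1 / (1 + τ)) = (explicitE0 n μ v ρ τ : EReal) := by
  rw [gallagerE0_one_div μ hn hv hτ, gallagerIntegral_eq hn μ hv hρ hτ, ENNReal.log_ofReal,
    if_neg (not_le.2 (Real.exp_pos _)), Real.log_exp]
  simp

/-- The function `E₀` vanishes at zero, since the output density integrates to one. -/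
theorem explicitE0_zero (hn : 1 ≤ n) (hv : 0 < v) (hρ : 0 < ρ) : explicitE0 n μ v ρ 0 = 0 := by
  have h := gallagerIntegral_eq hn μ hv hρ le_rfl
  have h2 : gallagerIntegral n μ v ρ 0 = 1 := by
    simpa [gallagerIntegral] using lintegral_shellPower_one (ρ := ρ) μ hn hv
  rw [h2] at h
  have h3 := congrArg ENNReal.toReal h
  rw [ENNReal.toReal_one, ENNReal.toReal_ofReal (Real.exp_pos _).le] at h3
  have := Real.exp_eq_one_iff _ |>.1 h3.symm
  linarith

theorem continuousOn_shellPower (hn : 1 ≤ n) (hv : 0 < v) (y : Block n) :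
    ContinuousOn (fun s => shellPower μ v ρ s y) (Ici 0) := by
  have := isProbabilityMeasure_shellLaw hn ρ
  intro s hs
  have hm := measurable_blockDensity_left μ hv y
  refine tendsto_lintegral_filter_of_dominated_convergence (fun _ => 1)
    (Eventually.of_forall fun t => (hm.pow_const t).ennreal_ofReal) ?_ (by simp) ?_
  · filter_upwards [self_mem_nhdsWithin] with t ht
    refine Eventually.of_forall fun x => ?_
    rw [← ENNReal.ofReal_one]
    exact ENNReal.ofReal_le_ofReal (Real.rpow_le_one (blockDensity_pos μ hv x y).le
      (blockDensity_le_one μ hv x y) ht)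
  · refine Eventually.of_forall fun x => ?_
    refine (ENNReal.continuous_ofReal.tendsto _).comp ?_
    exact ((Real.continuousAt_const_rpow (blockDensity_pos μ hv x y).ne').tendsto).mono_left
      nhdsWithin_le_nhds

/-- Continuity of Gallager's integral: by the monotonicity of power means, the output density
dominates the integrand for all `τ ≥ 0`. -/
theorem continuousOn_gallagerIntegral (hn : 1 ≤ n) (hv : 0 < v) :
    ContinuousOn (gallagerIntegral n μ v ρ) (Ici 0) := by
  intro τ hτ
  have hτ : 0 ≤ τ := hτ
  refine tendsto_lintegral_filter_of_dominated_convergence (fun y => shellPower μ v ρ 1 y)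
    (Eventually.of_forall fun t => (measurable_shellPower μ hn hv _).pow_const _) ?_
    (by rw [lintegral_shellPower_one μ hn hv]; simp) ?_
  · filter_upwards [self_mem_nhdsWithin] with t ht
    exact Eventually.of_forall fun y => shellPower_rpow_le μ hn hv ht y
  · refine Eventually.of_forall fun y => ?_
    have hfin : ∀ t, 0 ≤ t → shellPower μ v ρ (1 / (1 + t)) y ≠ ∞ := fun t ht =>
      ne_top_of_le_ne_top ENNReal.one_ne_top (shellPower_le_one μ hn hv (by positivity) y)
    have hpos : ∀ t, 0 ≤ t → 0 < (shellPower μ v ρ (1 / (1 + t)) y).toReal := fun t ht =>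
      ENNReal.toReal_pos (shellPower_pos μ hn hv _ y).ne' (hfin t ht)
    have hinner : Tendsto (fun t : ℝ => 1 / (1 + t)) (𝓝[Ici 0] τ) (𝓝[Ici 0] (1 / (1 + τ))) := by
      refine tendsto_nhdsWithin_of_tendsto_nhds_of_eventually_within _ ?_ ?_
      · refine Tendsto.mono_left ?_ nhdsWithin_le_nhds
        have : ContinuousAt (fun t : ℝ => 1 / (1 + t)) τ := by
          refine ContinuousAt.div continuousAt_const (by fun_prop) (by positivity)
        exact this
      · filter_upwards [self_mem_nhdsWithin] with t ht
        have ht : 0 ≤ t := ht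
        exact mem_Ici.2 (by positivity)
    have h1 : Tendsto (fun t => (shellPower μ v ρ (1 / (1 + t)) y).toReal) (𝓝[Ici 0] τ)
        (𝓝 (shellPower μ v ρ (1 / (1 + τ)) y).toReal) :=
      (ENNReal.tendsto_toReal (hfin τ hτ)).comp
        ((continuousOn_shellPower μ hn hv y _ (mem_Ici.2 (by positivity))).tendsto.comp hinner)
    have h2 : Tendsto (fun t => (shellPower μ v ρ (1 / (1 + t)) y).toReal ^ (1 + t)) (𝓝[Ici 0] τ)
        (𝓝 ((shellPower μ v ρ (1 / (1 + τ)) y).toReal ^ (1 + τ))) := by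
      refine h1.rpow ?_ (Or.inl (hpos τ hτ).ne')
      exact Tendsto.mono_left (Continuous.tendsto (by fun_prop) τ) nhdsWithin_le_nhds
    have h3 : ∀ t, 0 ≤ t → ENNReal.ofReal ((shellPower μ v ρ (1 / (1 + t)) y).toReal ^ (1 + t)) =
        shellPower μ v ρ (1 / (1 + t)) y ^ (1 + t) := fun t ht => by
      rw [← ENNReal.ofReal_rpow_of_pos (hpos t ht), ENNReal.ofReal_toReal (hfin t ht)]
    rw [← h3 τ hτ]
    refine ((ENNReal.continuous_ofReal.tendsto _).comp h2).congr' ?_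
    filter_upwards [self_mem_nhdsWithin] with t ht
    exact h3 t ht

theorem continuousOn_explicitE0 (hn : 1 ≤ n) (hv : 0 < v) (hρ : 0 < ρ) :
    ContinuousOn (explicitE0 n μ v ρ) (Ici 0) := by
  have h : EqOn (explicitE0 n μ v ρ)
      (fun τ => -Real.log (gallagerIntegral n μ v ρ τ).toReal) (Ici 0) := by
    intro τ hτ
    simp only
    rw [gallagerIntegral_eq hn μ hv hρ hτ, ENNReal.toReal_ofReal (Real.exp_pos _).le,
      Real.log_exp, neg_neg]
  refine ContinuousOn.congr ?_ h
  intro τ hτ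
  have hfin := ne_top_of_le_ne_top ENNReal.one_ne_top
    (gallagerIntegral_le_one (ρ := ρ) hn μ hv hτ)
  refine Tendsto.neg (Tendsto.log ((ENNReal.tendsto_toReal hfin).comp
    (continuousOn_gallagerIntegral μ hn hv τ hτ)) ?_)
  exact (ENNReal.toReal_pos (gallagerIntegral_pos hn μ hv hτ).ne' hfin).ne'

/-- The error exponent is attained at some `τ`. -/
theorem isGreatest_rce (hn : 1 ≤ n) (hv : 0 < v) (hρ : 0 < ρ) (R : ℝ) :
    IsGreatest ((fun τ : ℝ => explicitE0 n μ v ρ τ - τ * n * R) '' Icc 0 1) (rce n μ v R ρ) := by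
  refine IsCompact.isGreatest_sSup (isCompact_Icc.image_of_continuousOn ?_)
    ((nonempty_Icc.2 zero_le_one).image _)
  refine ContinuousOn.sub ((continuousOn_explicitE0 μ hn hv hρ).mono Icc_subset_Ici_self) ?_
  fun_prop

end Gallager

/-! ### The random coding bound -/

section RandomCoding

variable {A B : Type*} {M : ℕ}

/-- Gallager's bound `W_j ^ s * (∑_{m ≠ j} W_m ^ s) ^ τ` on the likelihood of an output `y` at which
the codeword `j` does not win, `s = 1 / (1 + τ)`. -/
noncomputable def gallagerTerm (W : A → B → ℝ≥0∞) (τ : ℝ) (j : Fin M) (f : Fin M → A) (y : B) :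
    ℝ≥0∞ :=
  W (f j) y ^ (1 / (1 + τ)) * (∑ m ∈ Finset.univ.erase j, W (f m) y ^ (1 / (1 + τ))) ^ τ

theorem le_gallagerTerm (W : A → B → ℝ≥0∞) {τ : ℝ} (hτ : 0 ≤ τ) {j m : Fin M} (hm : m ≠ j)
    (f : Fin M → A) {y : B} (h : W (f j) y ≤ W (f m) y) :
    W (f j) y ≤ gallagerTerm W τ j f y := by
  have h1 : 0 < 1 + τ := by linarith
  have hs : 0 ≤ 1 / (1 + τ) := by positivity
  calc W (f j) y = W (f j) y ^ (1 / (1 + τ)) * (W (f j) y ^ (1 / (1 + τ))) ^ τ := by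
        rw [← ENNReal.rpow_mul, ← ENNReal.rpow_add_of_nonneg _ _ hs (by positivity),
          ← mul_one_add, one_div_mul_cancel h1.ne', ENNReal.rpow_one]
    _ ≤ _ := by
        unfold gallagerTerm
        gcongr
        refine le_trans ?_ (Finset.single_le_sum (f := fun m => W (f m) y ^ (1 / (1 + τ)))
          (fun _ _ => zero_le) (Finset.mem_erase.2 ⟨hm, Finset.mem_univ m⟩))
        gcongr

variable [MeasurableSpace A] [MeasurableSpace B]

theorem measurable_gallagerTerm {W : A → B → ℝ≥0∞} (hW : Measurable (Function.uncurry W)) (τ : ℝ)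
    (j : Fin M) : Measurable (Function.uncurry (gallagerTerm W τ j)) := by
  have h : ∀ m : Fin M, Measurable fun p : (Fin M → A) × B => W (p.1 m) p.2 := fun m =>
    hW.comp (f := fun p : (Fin M → A) × B => (p.1 m, p.2)) (by fun_prop)
  exact ((h j).pow_const _).mul
    ((Finset.measurable_sum _ fun m _ => (h m).pow_const _).pow_const τ)

/-- The mean of Gallager's bound over independent codewords: the transmitted codeword is independent
of the others, and Jensen's inequality moves the mean inside the power `τ`. -/
theorem lintegral_gallagerTerm_le {ν : Measure A} [IsProbabilityMeasure ν] {κ : Measure B}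
    [SFinite κ] {W : A → B → ℝ≥0∞} (hW : Measurable (Function.uncurry W)) {τ : ℝ}
    (h0 : 0 ≤ τ) (h1 : τ ≤ 1) (j : Fin M) :
    ∫⁻ f, ∫⁻ y, gallagerTerm W τ j f y ∂κ ∂(Measure.pi fun _ : Fin M => ν) ≤
      (M : ℝ≥0∞) ^ τ * ∫⁻ y, (∫⁻ a, W a y ^ (1 / (1 + τ)) ∂ν) ^ (1 + τ) ∂κ := by
  rw [lintegral_lintegral_swap (measurable_gallagerTerm hW τ j).aemeasurable]
  have hWy : ∀ y, Measurable fun a => W a y := fun y => hW.comp measurable_prodMk_right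
  have hΦ : Measurable fun y => ∫⁻ a, W a y ^ (1 / (1 + τ)) ∂ν :=
    Measurable.lintegral_prod_left (hW.pow_const _)
  rw [← lintegral_const_mul _ (hΦ.pow_const _)]
  refine lintegral_mono fun y => ?_
  set X : Fin M → (Fin M → A) → ℝ≥0∞ := fun m f => W (f m) y ^ (1 / (1 + τ)) with hX
  have hXm : ∀ m, Measurable (X m) := fun m => ((hWy y).comp (measurable_pi_apply m)).pow_const _
  have hind : ProbabilityTheory.iIndepFun X (Measure.pi fun _ : Fin M => ν) :=
    ProbabilityTheory.iIndepFun_pi (X := fun _ a => W a y ^ (1 / (1 + τ)))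
      fun _ => ((hWy y).pow_const _).aemeasurable
  have hmean : ∀ m, ∫⁻ f, X m f ∂(Measure.pi fun _ : Fin M => ν) =
      ∫⁻ a, W a y ^ (1 / (1 + τ)) ∂ν := fun m =>
    (measurePreserving_eval (fun _ : Fin M => ν) m).lintegral_comp ((hWy y).pow_const _)
  have hsum : Measurable fun f => ∑ m ∈ Finset.univ.erase j, X m f :=
    Finset.measurable_sum _ fun m _ => hXm m
  have hindep : ProbabilityTheory.IndepFun (X j)
      (fun f => (∑ m ∈ Finset.univ.erase j, X m f) ^ τ) (Measure.pi fun _ : Fin M => ν) := by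
    have h := (hind.indepFun_finsetSum_of_notMem hXm (Finset.notMem_erase j Finset.univ)).symm
    have h2 := h.comp (φ := id) (ψ := fun t : ℝ≥0∞ => t ^ τ) measurable_id
      (measurable_id.pow_const τ)
    have h3 : (fun f => (∑ m ∈ Finset.univ.erase j, X m f) ^ τ) =
        (fun t : ℝ≥0∞ => t ^ τ) ∘ ∑ m ∈ Finset.univ.erase j, X m := by
      ext f
      simp
    rw [h3]
    exact h2
  calc ∫⁻ f, gallagerTerm W τ j f y ∂(Measure.pi fun _ : Fin M => ν)
      = (∫⁻ f, X j f ∂(Measure.pi fun _ : Fin M => ν)) *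
        ∫⁻ f, (∑ m ∈ Finset.univ.erase j, X m f) ^ τ ∂(Measure.pi fun _ : Fin M => ν) :=
        ProbabilityTheory.lintegral_mul_eq_lintegral_mul_lintegral_of_indepFun
          (hXm j) (hsum.pow_const τ) hindep
    _ ≤ (∫⁻ a, W a y ^ (1 / (1 + τ)) ∂ν) *
        ((M : ℝ≥0∞) * ∫⁻ a, W a y ^ (1 / (1 + τ)) ∂ν) ^ τ := by
        rw [hmean]
        gcongr
        refine (lintegral_rpow_le hsum h0 h1).trans ?_
        gcongr
        rw [lintegral_finsetSum _ fun m _ => hXm m]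
        simp_rw [hmean]
        rw [Finset.sum_const, nsmul_eq_mul]
        gcongr
        exact_mod_cast (Finset.card_le_univ _).trans_eq (Fintype.card_fin M)
    _ = _ := by
        rw [ENNReal.mul_rpow_of_nonneg _ _ h0, ENNReal.rpow_add_of_nonneg _ _ zero_le_one h0,
          ENNReal.rpow_one]
        ring

/-- A finite family of measurable functions has a measurable selection of the index of a maximum,
namely the smallest such index. -/
theorem exists_measurable_argmax (hM : 1 ≤ M) (w : Fin M → B → ℝ) (hw : ∀ m, Measurable (w m)) :
    ∃ g : B → Fin M, Measurable g ∧ ∀ y m, w m y ≤ w (g y) y := by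
  classical
  have : Nonempty (Fin M) := ⟨⟨0, hM⟩⟩
  -- `q y k` says that the index `k` attains the maximum at `y`.
  let q : B → ℕ → Prop := fun y k => ∃ h : k < M, ∀ m, w m y ≤ w ⟨k, h⟩ y
  have hq : ∀ y, ∃ k, q y k := fun y => by
    obtain ⟨m, hm⟩ := Finite.exists_max fun m => w m y
    exact ⟨m, m.2, hm⟩
  have hmeas : Measurable fun y => Nat.find (hq y) := by
    refine measurable_find hq fun k => ?_
    by_cases h : k < M
    · have : {y | q y k} = ⋂ m, {y | w m y ≤ w ⟨k, h⟩ y} := by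
        ext y
        simp [q, h]
      rw [this]
      exact MeasurableSet.iInter fun m => measurableSet_le (hw m) (hw _)
    · have : {y | q y k} = ∅ := by
        ext y
        simp [q, h]
      rw [this]
      exact MeasurableSet.empty
  refine ⟨fun y => ⟨Nat.find (hq y), (Nat.find_spec (hq y)).1⟩, ?_, fun y m =>
    (Nat.find_spec (hq y)).2 m⟩
  refine measurable_to_countable' fun j => ?_
  have : (fun y => (⟨Nat.find (hq y), (Nat.find_spec (hq y)).1⟩ : Fin M)) ⁻¹' {j} =
      (fun y => Nat.find (hq y)) ⁻¹' {(j : ℕ)} := by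
    ext y
    simp [Fin.ext_iff]
  rw [this]
  exact hmeas (measurableSet_singleton _)

end RandomCoding

section Channel

variable {ℓ n : ℕ} (μ : ℂ) {v ρ : ℝ}

/-- The likelihood of the output `y` of `ℓ` blocks. -/
noncomputable def likelihood (μ : ℂ) (v : ℝ) (x y : Fin ℓ → Block n) : ℝ≥0∞ :=
  ∏ k, ENNReal.ofReal (blockDensity μ v (x k) (y k))

theorem likelihood_eq (hv : 0 < v) (x y : Fin ℓ → Block n) :
    likelihood μ v x y = ENNReal.ofReal (∏ k, blockDensity μ v (x k) (y k)) := by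
  rw [likelihood, ENNReal.ofReal_prod_of_nonneg fun k _ => (blockDensity_pos μ hv _ _).le]

theorem measurable_likelihood (hv : 0 < v) :
    Measurable (Function.uncurry (likelihood (ℓ := ℓ) (n := n) μ v)) := by
  have h : ∀ k : Fin ℓ, Measurable fun p : (Fin ℓ → Block n) × (Fin ℓ → Block n) =>
      ENNReal.ofReal (blockDensity μ v (p.1 k) (p.2 k)) := fun k =>
    (Measurable.comp (g := fun p : Block n × Block n => blockDensity μ v p.1 p.2)
      (f := fun p : (Fin ℓ → Block n) × (Fin ℓ → Block n) => (p.1 k, p.2 k))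
      (measurable_blockDensity μ hv) (by fun_prop)).ennreal_ofReal
  exact Finset.measurable_prod Finset.univ fun k _ => h k

theorem channelLaw_eq (hv : 0 < v) (x : Fin ℓ → Block n) :
    channelLaw μ v x = (Measure.pi fun _ : Fin ℓ => (volume : Measure (Block n))).withDensity
      (likelihood μ v x) := by
  have hs : ∀ k, SigmaFinite ((volume : Measure (Block n)).withDensity
      fun y => ENNReal.ofReal (blockDensity μ v (x k) y)) := by
    intro k
    have := isProbabilityMeasure_blockLaw μ hv (x k)
    rw [← blockLaw_eq μ hv]
    infer_instance
  rw [channelLaw]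
  simp_rw [blockLaw_eq μ hv]
  exact pi_withDensity (fun _ => volume) (fun k y => ENNReal.ofReal (blockDensity μ v (x k) y))
    fun k => (measurable_blockDensity_right μ hv (x k)).ennreal_ofReal

/-- Since the channel is memoryless, the integral in the random coding bound is a power of the
integral for one block. -/
theorem lintegral_likelihood (hn : 1 ≤ n) (hv : 0 < v) {τ : ℝ} (hτ : 0 ≤ τ) :
    ∫⁻ y, (∫⁻ x, likelihood μ v x y ^ (1 / (1 + τ))
      ∂(Measure.pi fun _ : Fin ℓ => shellLaw n ρ)) ^ (1 + τ)
      ∂(Measure.pi fun _ : Fin ℓ => (volume : Measure (Block n))) =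
    gallagerIntegral n μ v ρ τ ^ ℓ := by
  have := isProbabilityMeasure_shellLaw hn ρ
  have h1 : 0 < 1 + τ := by linarith
  have h2 : ∀ y : Fin ℓ → Block n, (∫⁻ x, likelihood μ v x y ^ (1 / (1 + τ))
      ∂(Measure.pi fun _ : Fin ℓ => shellLaw n ρ)) ^ (1 + τ) =
      ∏ k, shellPower μ v ρ (1 / (1 + τ)) (y k) ^ (1 + τ) := by
    intro y
    rw [ENNReal.prod_rpow_of_nonneg h1.le]
    congr 1
    have h3 : ∀ x : Fin ℓ → Block n, likelihood μ v x y ^ (1 / (1 + τ)) =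
        ∏ k, ENNReal.ofReal (blockDensity μ v (x k) (y k) ^ (1 / (1 + τ))) := by
      intro x
      rw [likelihood, ← ENNReal.prod_rpow_of_nonneg (by positivity)]
      exact Finset.prod_congr rfl fun k _ =>
        ENNReal.ofReal_rpow_of_pos (blockDensity_pos μ hv _ _)
    simp_rw [h3]
    exact lintegral_fin_prod (fun _ => shellLaw n ρ)
      (fun k x => ENNReal.ofReal (blockDensity μ v x (y k) ^ (1 / (1 + τ))))
      fun k => ((measurable_blockDensity_left μ hv (y k)).pow_const _).ennreal_ofReal
  simp_rw [h2]
  rw [lintegral_fin_prod (fun _ => (volume : Measure (Block n)))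
    (fun _ y => shellPower μ v ρ (1 / (1 + τ)) y ^ (1 + τ))
    fun _ => (measurable_shellPower μ hn hv _).pow_const _]
  simp [gallagerIntegral]

/-- The error probability of maximum-likelihood decoding is at most the integral of Gallager's
bound. -/
theorem channelLaw_error_le {M : ℕ} (hv : 0 < v) {τ : ℝ} (hτ : 0 ≤ τ)
    (f : Fin M → Fin ℓ → Block n) {g : (Fin ℓ → Block n) → Fin M} (hg : Measurable g)
    (hml : IsMaxLikelihood μ v f g) (j : Fin M) :
    channelLaw μ v (f j) {y | g y ≠ j} ≤
      ∫⁻ y, gallagerTerm (likelihood μ v) τ j f y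
        ∂(Measure.pi fun _ : Fin ℓ => (volume : Measure (Block n))) := by
  have hs : MeasurableSet {y | g y ≠ j} := hg (measurableSet_singleton j).compl
  rw [channelLaw_eq μ hv, withDensity_apply _ hs]
  refine (setLIntegral_mono' hs fun y hy => ?_).trans (setLIntegral_le_lintegral _ _)
  refine le_gallagerTerm (likelihood μ v) hτ hy f ?_
  rw [likelihood_eq μ hv, likelihood_eq μ hv]
  exact ENNReal.ofReal_le_ofReal (hml y j)

/-- The random coding bound: some codebook on the shell does at least as well as the average
one. -/
theorem exists_codebook {M : ℕ} (hn : 1 ≤ n) (hv : 0 < v) (hρ : 0 < ρ) {τ : ℝ} (h0 : 0 ≤ τ)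
    (h1 : τ ≤ 1) :
    ∃ f : Fin M → Fin ℓ → Block n, (∀ m k, ‖f m k‖ ^ 2 = n * ρ) ∧
      ∑ j, ∫⁻ y, gallagerTerm (likelihood μ v) τ j f y
        ∂(Measure.pi fun _ : Fin ℓ => (volume : Measure (Block n))) ≤
      M * ((M : ℝ≥0∞) ^ τ * gallagerIntegral n μ v ρ τ ^ ℓ) := by
  have := isProbabilityMeasure_shellLaw hn ρ
  have hW := measurable_likelihood (ℓ := ℓ) (n := n) μ hv
  set P : Measure (Fin M → Fin ℓ → Block n) :=
    Measure.pi fun _ : Fin M => Measure.pi fun _ : Fin ℓ => shellLaw n ρ with hP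
  have hae : ∀ᵐ f ∂P, ∀ m k, ‖f m k‖ ^ 2 = n * ρ := by
    simp_rw [ae_all_iff]
    intro m k
    exact ((measurePreserving_eval (fun _ : Fin ℓ => shellLaw n ρ) k).comp
      (measurePreserving_eval (fun _ : Fin M => Measure.pi fun _ : Fin ℓ => shellLaw n ρ)
        m)).quasiMeasurePreserving.ae (ae_shellLaw_norm_sq n hρ)
  have hmeas : ∀ j : Fin M, Measurable fun f : Fin M → Fin ℓ → Block n =>
      ∫⁻ y, gallagerTerm (likelihood μ v) τ j f y
        ∂(Measure.pi fun _ : Fin ℓ => (volume : Measure (Block n))) := fun j =>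
    Measurable.lintegral_prod_right (measurable_gallagerTerm hW τ j)
  obtain ⟨f, hf, hle⟩ := exists_notMem_null_le_lintegral (μ := P)
    (Finset.measurable_sum Finset.univ fun j _ => hmeas j).aemeasurable (ae_iff.1 hae)
  refine ⟨f, by simpa using hf, hle.trans ?_⟩
  rw [lintegral_finsetSum _ fun j _ => hmeas j]
  refine (Finset.sum_le_card_nsmul _ _ ((M : ℝ≥0∞) ^ τ * gallagerIntegral n μ v ρ τ ^ ℓ)
    fun j _ => ?_).trans (by simp)
  rw [← lintegral_likelihood μ hn hv h0]
  exact lintegral_gallagerTerm_le hW h0 h1 j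

theorem epsUB_eq (hℓ : 1 ≤ ℓ) (hn : 1 ≤ n) {M : ℕ} (hM : 1 ≤ M) {τ : ℝ}
    (hτ : explicitE0 n μ v ρ τ - τ * n * (Real.log M / (n * ℓ)) =
      rce n μ v (Real.log M / (n * ℓ)) ρ) :
    epsUB ℓ n M μ v ρ = (M : ℝ) ^ τ * Real.exp (-explicitE0 n μ v ρ τ) ^ ℓ := by
  have hM0 : (0 : ℝ) < M := by exact_mod_cast hM
  have hn0 : (n : ℝ) ≠ 0 := by positivity
  have hℓ0 : (ℓ : ℝ) ≠ 0 := by positivity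
  rw [epsUB, ← hτ, Real.rpow_def_of_pos hM0, ← Real.exp_nat_mul, ← Real.exp_add]
  congr 1
  field_simp
  ring

/-- The random coding bound at the optimal `τ`, with a maximum-likelihood decoder. -/
theorem exists_code (hℓ : 1 ≤ ℓ) (hn : 1 ≤ n) (hv : 0 < v) (hρ : 0 < ρ) {M : ℕ} (hM : 1 ≤ M) :
    ∃ (f : Fin M → Fin ℓ → Block n) (g : (Fin ℓ → Block n) → Fin M),
      IsCode μ v (epsUB ℓ n M μ v ρ) ρ f g ∧ IsMaxLikelihood μ v f g := by
  obtain ⟨⟨τ, ⟨h0, h1⟩, hτ⟩, -⟩ := isGreatest_rce μ hn hv hρ (Real.log M / (n * ℓ))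
  obtain ⟨f, hf, hle⟩ := exists_codebook (ℓ := ℓ) (M := M) μ hn hv hρ h0 h1
  obtain ⟨g, hg, hml⟩ := exists_measurable_argmax hM
    (fun m (y : Fin ℓ → Block n) => ∏ k, blockDensity μ v (f m k) (y k))
    (fun m => Finset.measurable_prod _ fun k _ =>
      (measurable_blockDensity_right μ hv (f m k)).comp (measurable_pi_apply k))
  refine ⟨f, g, ⟨hf, hg, ?_⟩, hml⟩
  have hM0 : (0 : ℝ) < M := by exact_mod_cast hM
  have hprob : ∀ j, IsProbabilityMeasure (channelLaw μ v (f j)) := by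
    intro j
    have := fun k => isProbabilityMeasure_blockLaw μ hv (f j k)
    unfold channelLaw
    infer_instance
  have hsum : ENNReal.ofReal (∑ j, (channelLaw μ v (f j)).real {y | g y ≠ j}) ≤
      ENNReal.ofReal (M * epsUB ℓ n M μ v ρ) := by
    rw [ENNReal.ofReal_sum_of_nonneg fun j _ => measureReal_nonneg]
    calc ∑ j, ENNReal.ofReal ((channelLaw μ v (f j)).real {y | g y ≠ j})
        = ∑ j, channelLaw μ v (f j) {y | g y ≠ j} :=
          Finset.sum_congr rfl fun j _ => ofReal_measureReal (measure_ne_top _ _)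
      _ ≤ _ := Finset.sum_le_sum fun j _ => channelLaw_error_le μ hv h0 f hg hml j
      _ ≤ _ := hle
      _ = _ := by
        rw [epsUB_eq μ hℓ hn hM hτ, gallagerIntegral_eq hn μ hv hρ h0,
          ENNReal.ofReal_mul hM0.le, ENNReal.ofReal_mul (by positivity),
          ENNReal.ofReal_pow (Real.exp_pos _).le, ← ENNReal.ofReal_rpow_of_pos hM0,
          ENNReal.ofReal_natCast]
  have heps : 0 < epsUB ℓ n M μ v ρ := Real.exp_pos _
  have hreal := (ENNReal.ofReal_le_ofReal_iff (by positivity)).1 hsum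
  rw [avgError, one_div, inv_mul_le_iff₀ hM0]
  exact hreal

/-- The bound on the error probability tends to one with the number of messages: the exponent is
small because `E₀` is small for small `τ`, and the rate outweighs `E₀` for the other `τ`. -/
theorem finite_setOf_epsUB_le (hℓ : 1 ≤ ℓ) (hn : 1 ≤ n) (hv : 0 < v) (hρ : 0 < ρ) {ε : ℝ}
    (hε : 0 < ε) (hε1 : ε < 1) : {M : ℕ | 1 ≤ M ∧ epsUB ℓ n M μ v ρ ≤ ε}.Finite := by
  have hn0 : (0 : ℝ) < n := by exact_mod_cast hn
  have hℓ0 : (0 : ℝ) < ℓ := by exact_mod_cast hℓ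
  have hcont := continuousOn_explicitE0 (n := n) (ρ := ρ) μ hn hv hρ
  set δ : ℝ := -Real.log ε / ℓ with hδ
  have hδ0 : 0 < δ := div_pos (neg_pos.2 (Real.log_neg hε hε1)) hℓ0
  have hev : ∀ᶠ τ in 𝓝[Ici 0] (0 : ℝ), explicitE0 n μ v ρ τ < δ := by
    refine (hcont 0 self_mem_Ici).eventually (gt_mem_nhds ?_)
    rwa [explicitE0_zero μ hn hv hρ]
  obtain ⟨η, hη, hsmall⟩ : ∃ η : ℝ, 0 < η ∧ ∀ τ, 0 ≤ τ → τ < η → explicitE0 n μ v ρ τ < δ := by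
    obtain ⟨η, hη, h⟩ := Metric.mem_nhdsWithin_iff.1 hev
    refine ⟨η, hη, fun τ h0 h1 => h ⟨?_, h0⟩⟩
    rwa [Metric.mem_ball, Real.dist_eq, sub_zero, abs_of_nonneg h0]
  obtain ⟨C, hC⟩ := (isCompact_Icc.image_of_continuousOn
    (hcont.mono (Icc_subset_Ici_self : Icc (0 : ℝ) 1 ⊆ Ici 0))).bddAbove
  refine (finite_Iic ⌈Real.exp (ℓ * C / η)⌉₊).subset fun M hMε => ?_
  obtain ⟨hM, hMle⟩ := hMε
  have hM0 : (0 : ℝ) < M := by exact_mod_cast hM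
  have hlogM : 0 ≤ Real.log M := Real.log_natCast_nonneg M
  obtain ⟨⟨τ, ⟨h0, h1⟩, hτ⟩, -⟩ := isGreatest_rce μ hn hv hρ (Real.log M / (n * ℓ))
  have hrce : δ ≤ rce n μ v (Real.log M / (n * ℓ)) ρ := by
    rw [epsUB, ← Real.le_log_iff_exp_le hε] at hMle
    rw [hδ, div_le_iff₀ hℓ0]
    linarith
  rw [← hτ] at hrce
  have hrate : τ * n * (Real.log M / (n * ℓ)) = τ * Real.log M / ℓ := by
    field_simp
  simp only [hrate] at hrce
  have hnn : 0 ≤ τ * Real.log M / ℓ := by positivity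
  have hητ : η ≤ τ := by
    by_contra hlt
    have := hsmall τ h0 (not_le.1 hlt)
    linarith
  have hCτ : explicitE0 n μ v ρ τ ≤ C := hC ⟨τ, ⟨h0, h1⟩, rfl⟩
  have hlog : η * Real.log M / ℓ ≤ C := by
    have : η * Real.log M / ℓ ≤ τ * Real.log M / ℓ := by gcongr
    linarith
  rw [div_le_iff₀ hℓ0] at hlog
  have hlog2 : Real.log M ≤ ℓ * C / η := by
    rw [le_div_iff₀ hη]
    linarith
  rw [Real.log_le_iff_le_exp hM0] at hlog2
  exact mem_Iic.2 (by exact_mod_cast hlog2.trans (Nat.le_ceil _))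

theorem sSup_le_maxRate (hℓ : 1 ≤ ℓ) (hn : 1 ≤ n) (hv : 0 < v) (hρ : 0 < ρ) (ε : ℝ) :
    sSup ((fun M : ℕ => ((Real.logb 2 M / (n * ℓ) : ℝ) : EReal)) ''
      {M : ℕ | 1 ≤ M ∧ epsUB ℓ n M μ v ρ ≤ ε}) ≤ maxRate ℓ n μ v ε ρ := by
  refine sSup_le ?_
  rintro _ ⟨M, ⟨hM, hle⟩, rfl⟩
  obtain ⟨f, g, hcode, -⟩ := exists_code μ hℓ hn hv hρ hM
  exact le_sSup ⟨M, hM, ⟨f, g, hcode.power, hcode.measurable_decoder, hcode.error_le.trans hle⟩,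
    by rw [mul_comm (n : ℝ)]⟩

end Channel

end BlockFading

theorem mainTheorem2 (ℓ n : ℕ) (hℓ : 1 ≤ ℓ) (hn : 1 ≤ n) (μ : ℂ) (v ρ : ℝ) (hv : 0 < v)
    (hρ : 0 < ρ) :
    -- convergence of the integrals that define the explicit function
    (∀ τ ∈ Icc (0 : ℝ) 1,
      (∀ r : ℝ, 0 < r → IntegrableOn (jIntegrand n μ v ρ r τ) (Ioi 0)) ∧
      IntegrableOn (e0Integrand n μ v ρ τ) (Ioi 0)) ∧
    -- the explicit function is Gallager's function at s = 1 / (1 + τ), which is the optimal s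
    (∀ τ ∈ Icc (0 : ℝ) 1,
      gallagerE0 n μ v ρ τ (1 / (1 + τ)) = (explicitE0 n μ v ρ τ : EReal) ∧
      ∀ s : ℝ, 0 ≤ s → gallagerE0 n μ v ρ τ s ≤ gallagerE0 n μ v ρ τ (1 / (1 + τ))) ∧
    -- the exponent is a maximum over τ
    (∀ R : ℝ, IsGreatest ((fun τ : ℝ => explicitE0 n μ v ρ τ - τ * n * R) '' Icc 0 1)
      (rce n μ v R ρ)) ∧
    -- existence of codes with maximum-likelihood decoding
    (∀ M : ℕ, 1 ≤ M →
      ∃ (f : Fin M → Fin ℓ → Block n) (g : (Fin ℓ → Block n) → Fin M),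
        IsCode μ v (epsUB ℓ n M μ v ρ) ρ f g ∧ IsMaxLikelihood μ v f g) ∧
    -- the bound on the maximum coding rate; the supremum over a finite set is a maximum
    (∀ ε : ℝ, 0 < ε → ε < 1 →
      {M : ℕ | 1 ≤ M ∧ epsUB ℓ n M μ v ρ ≤ ε}.Finite ∧
      sSup ((fun M : ℕ => ((Real.logb 2 M / (n * ℓ) : ℝ) : EReal)) ''
          {M : ℕ | 1 ≤ M ∧ epsUB ℓ n M μ v ρ ≤ ε})
        ≤ maxRate ℓ n μ v ε ρ) := by
  refine ⟨fun τ hτ => ⟨fun r hr => integrableOn_jIntegrand hn μ hv hρ hτ.1 hr,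
      integrableOn_e0Integrand hn μ hv hρ hτ.1⟩,
    fun τ hτ => ⟨gallagerE0_eq_explicitE0 μ hn hv hρ hτ.1,
      fun s hs => gallagerE0_le μ hn hv hτ.1 hs⟩,
    isGreatest_rce μ hn hv hρ,
    fun M hM => exists_code μ hℓ hn hv hρ hM,
    fun ε hε hε1 => ⟨finite_setOf_epsUB_le μ hℓ hn hv hρ hε hε1,
      sSup_le_maxRate μ hℓ hn hv hρ ε⟩⟩
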